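/- **Proposition 1 (Stable).** Let $\alpha\in(0,1)$ and let $$\Lambda^s_\alpha:=\Big\{\lambda\in\mathbb C\setminus\{0\}:\ |\arg\lambda|>\frac{\alpha\pi}{2}\Big\},\qquad \arg\lambda\in(-\pi,\pi].$$ For $f:[0,\infty)\to\mathbb R$ and $x_0\in\mathbb C$ consider the scalar Caputo initial value problem $${}^{C}\!D^{\alpha}_{0+}x(t)=\lambda x(t)+f(t)\quad (t>0),\qquad x(0)=x_0, \qquad(*)$$ where a solution is a continuous function $x:[0,\infty)\to\mathbb C$ with $x(0)=x_0$ that satisfies the equation for every $t>0$, and where $${}^{C}\!D^{\alpha}_{0+}x(t):=\frac{d}{dt}\,\frac{1}{\Gamma(1-\alpha)}\int_0^t (t-\tau)^{-\alpha}\,\big(x(\tau)-x(0)\big)\,d\tau$$ (the derivative being required to exist); for $x\in C^1([0,\infty))$ this equals $\frac{1}{\Gamma(1-\alpha)}\int_0^t (t-\tau)^{-\alpha}x'(\tau)\,d\tau$. If $\lambda\in\Lambda^s_\alpha$ and $f:[0,\infty)\to\mathbb R$ is bounded and continuous, then for every $x_0\in\mathbb C$ all solutions of $(*)$ are bounded on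 $[0,\infty)$. If, additionally, $\lim_{t\to\infty}f(t)=0$, then for every $x_0\in\mathbb C$ all solutions of $(*)$ tend to $0$ as $t\to\infty$. -/

import Mathlib

open Set Filter Topology

namespace FractionalPerron

noncomputable section

/-- The stable sector: nonzero complex numbers `z` with `|arg z| > α π / 2`, where
`arg z ∈ (-π, π]`. -/
def stableSector (α : ℝ) : Set ℂ :=
  {z : ℂ | z ≠ 0 ∧ α * Real.pi / 2 < |z.arg|}

/-- `ξ` is bounded on `[0, ∞)`. -/
def IsBoundedOnNonneg {E : Type*} [NormedAddCommGroup E] (ξ : ℝ → E) : Prop :=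
  ∃ M : ℝ, ∀ t : ℝ, 0 ≤ t → ‖ξ t‖ ≤ M

/-- The bounded continuous functions on `[0, ∞)`. A function on `[0, ∞)` is represented by a
function on `ℝ`, of which only the values on `[0, ∞)` matter. -/
def CInfty (E : Type*) [NormedAddCommGroup E] : Set (ℝ → E) :=
  {ξ | ContinuousOn ξ (Ici 0) ∧ IsBoundedOnNonneg ξ}

/-- The bounded continuous functions on `[0, ∞)` that tend to `0` at infinity. -/
def CInftyZero (E : Type*) [NormedAddCommGroup E] : Set (ℝ → E) :=
  {ξ | ξ ∈ CInfty E ∧ Tendsto (fun t => ‖ξ t‖) atTop (𝓝 0)}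

/-- The Riemann--Liouville integral of order `β > 0` with base point `0`:
`(I^β x)(t) = Γ(β)⁻¹ ∫₀ᵗ (t - τ)^(β - 1) x(τ) dτ`. -/
def rlIntegral {E : Type*} [NormedAddCommGroup E] [NormedSpace ℝ E]
    (β : ℝ) (x : ℝ → E) (t : ℝ) : E :=
  (1 / Real.Gamma β) • ∫ τ in (0 : ℝ)..t, (t - τ) ^ (β - 1) • x τ

/-- `x` has Riemann--Liouville derivative `y` of order `α ∈ (0, 1)` at `t`:
`(D I^(1 - α) x)(t)` exists and equals `y`. -/
def HasRLDerivAt {E : Type*} [NormedAddCommGroup E] [NormedSpace ℝ E]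
    (α : ℝ) (x : ℝ → E) (y : E) (t : ℝ) : Prop :=
  HasDerivAt (rlIntegral (1 - α) x) y t

/-- `x` has Caputo derivative `y` of order `α ∈ (0, 1)` at `t`: the Riemann--Liouville derivative
of `x - x(0)` at `t` exists and equals `y`. For `x` of class `C¹` on `[0, ∞)` this is
`(I^(1 - α) x')(t)`, by `hasCaputoDerivAt_of_contDiffOn` below; this form also makes sense for
functions that are only continuous, such as the solutions of fractional differential equations,
which behave like `x₀ + c t ^ α` near `0`. -/
def HasCaputoDerivAt {E : Type*} [NormedAddCommGroup E] [NormedSpace ℝ E]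
    (α : ℝ) (x : ℝ → E) (y : E) (t : ℝ) : Prop :=
  HasRLDerivAt α (fun s => x s - x 0) y t

/-- `x` solves the scalar initial value problem
`ᶜD^α x(t) = lam * x(t) + f(t)` for `t > 0`, `x(0) = x₀`, on `[0, ∞)`. -/
structure IsSolution (α : ℝ) (lam : ℂ) (f : ℝ → ℝ) (x₀ : ℂ) (x : ℝ → ℂ) : Prop where
  continuousOn : ContinuousOn x (Ici 0)
  initial : x 0 = x₀
  equation : ∀ t : ℝ, 0 < t → HasCaputoDerivAt α x (lam * x t + (f t : ℂ)) t

/-- For continuously differentiable functions on `[0, ∞)` the Caputo derivative is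
`(I^(1 - α) x')(t)`. -/
theorem hasCaputoDerivAt_of_contDiffOn {E : Type*} [NormedAddCommGroup E] [NormedSpace ℝ E]
    [CompleteSpace E] {α : ℝ} (hα : α ∈ Ioo (0 : ℝ) 1) {x : ℝ → E}
    (hx : ContDiffOn ℝ 1 x (Ici 0)) {t : ℝ} (ht : 0 < t) :
    HasCaputoDerivAt α x (rlIntegral (1 - α) (derivWithin x (Ici 0)) t) t := by
  obtain ⟨hα0, hα1⟩ := hα
  set x' := derivWithin x (Ici 0) with hx'
  have hdiff : DifferentiableOn ℝ x (Ici 0) := hx.differentiableOn (by norm_num)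
  have hx'c : ContinuousOn x' (Ici 0) := hx.continuousOn_derivWithin (uniqueDiffOn_Ici 0) le_rfl
  set T := t + 1 with hT
  -- the extension by `0` to negative times
  set y : ℝ → E := fun s => x (max s 0) - x 0 with hy
  have hyc : Continuous y := by
    have : Continuous fun s : ℝ => x (max s 0) :=
      hx.continuousOn.comp_continuous (by fun_prop) (fun s => mem_Ici.2 (le_max_right _ _))
    exact this.sub continuous_const
  obtain ⟨C, hC⟩ : ∃ C, ∀ s ∈ Icc 0 T, ‖x' s‖ ≤ C :=
    isCompact_Icc.exists_bound_of_continuousOn (hx'c.mono Icc_subset_Ici_self)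
  have hC0 : 0 ≤ C := (norm_nonneg _).trans (hC 0 ⟨le_rfl, by linarith⟩)
  have hylip : ∀ a ≤ T, ∀ b ≤ T, ‖y a - y b‖ ≤ C * ‖a - b‖ := by
    intro a ha b hb
    have h1 := (convex_Icc (0 : ℝ) T).norm_image_sub_le_of_norm_hasDerivWithin_le
      (f := x) (f' := x') (C := C)
      (fun s hs => ((hdiff s hs.1).hasDerivWithinAt).mono Icc_subset_Ici_self) hC
      (x := max b 0) (y := max a 0) ⟨le_max_right _ _, max_le hb (by linarith)⟩
      ⟨le_max_right _ _, max_le ha (by linarith)⟩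
    have h2 : ‖max a 0 - max b 0‖ ≤ ‖a - b‖ := abs_max_sub_max_le_abs a b 0
    calc ‖y a - y b‖ = ‖x (max a 0) - x (max b 0)‖ := by simp [hy]
      _ ≤ C * ‖max a 0 - max b 0‖ := h1
      _ ≤ _ := by gcongr
  set y' : ℝ → E := (Ioi 0).indicator x' with hy'
  have hyder : ∀ s : ℝ, s ≠ 0 → HasDerivAt y (y' s) s := by
    intro s hs
    rcases lt_or_gt_of_ne hs with h | h
    · have : y' s = 0 := by simp [hy', h.le]
      rw [this]
      refine (hasDerivAt_const s (0 : E)).congr_of_eventuallyEq ?_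
      filter_upwards [Iio_mem_nhds h] with u hu
      simp [hy, max_eq_right (le_of_lt (mem_Iio.1 hu))]
    · have : y' s = x' s := by simp [hy', h]
      rw [this]
      have h1 : HasDerivAt x (x' s) s :=
        ((hdiff s h.le).hasDerivWithinAt).hasDerivAt (Ici_mem_nhds h)
      refine (h1.sub_const (x 0)).congr_of_eventuallyEq ?_
      filter_upwards [Ioi_mem_nhds h] with u hu
      simp [hy, max_eq_left (le_of_lt (mem_Ioi.1 hu))]
  have hp : -1 < (1 - α) - 1 := by linarith
  set p := (1 - α) - 1 with hpdef
  have hint : IntervalIntegrable (fun u : ℝ => u ^ p) MeasureTheory.volume 0 T :=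
    intervalIntegral.intervalIntegrable_rpow' hp
  -- the convolution form of the integral on a fixed interval
  have hconv : ∀ s ∈ Ioo 0 T, ∀ w v : ℝ → E, (∀ r > 0, w r = v r) → (∀ r ≤ 0, w r = 0) →
      (IntervalIntegrable (fun u : ℝ => u ^ p • w (s - u)) MeasureTheory.volume 0 T) →
      ∫ τ in (0 : ℝ)..s, (s - τ) ^ p • v τ = ∫ u in (0 : ℝ)..T, u ^ p • w (s - u) := by
    intro s hs w v hwv hw0 hi
    have hTs : (∫ u in s..T, u ^ p • w (s - u)) = 0 := by
      rw [intervalIntegral.integral_congr (g := fun _ => (0 : E)), intervalIntegral.integral_zero]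
      intro u hu
      rw [uIcc_of_le hs.2.le] at hu
      simp [hw0 (s - u) (by linarith [hu.1])]
    have hsT : s ∈ uIcc 0 T := by rw [uIcc_of_le (hs.1.trans hs.2).le]; exact ⟨hs.1.le, hs.2.le⟩
    rw [← intervalIntegral.integral_add_adjacent_intervals
      (hi.mono_set (uIcc_subset_uIcc left_mem_uIcc hsT))
      (hi.mono_set (uIcc_subset_uIcc hsT right_mem_uIcc)), hTs, add_zero]
    have h1 := intervalIntegral.integral_comp_sub_left
      (fun u : ℝ => u ^ p • w (s - u)) s (a := 0) (b := s)
    simp only [sub_self, sub_zero, sub_sub_cancel] at h1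
    rw [← h1]
    refine intervalIntegral.integral_congr_ae (Eventually.of_forall fun τ hτ => ?_)
    rw [uIoc_of_le hs.1.le] at hτ
    simp only [hwv τ hτ.1]
  have hyi : ∀ s : ℝ, IntervalIntegrable (fun u : ℝ => u ^ p • y (s - u))
      MeasureTheory.volume 0 T := fun s =>
    hint.smul_continuousOn (hyc.comp (continuous_const.sub continuous_id)).continuousOn
  have hae : ∀ᵐ u : ℝ, u ≠ t := by
    simp [MeasureTheory.ae_iff, MeasureTheory.measure_singleton]
  have hy'meas : MeasureTheory.AEStronglyMeasurable y' MeasureTheory.volume :=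
    (aestronglyMeasurable_indicator_iff measurableSet_Ioi).2
      ((hx'c.mono Ioi_subset_Ici_self).aestronglyMeasurable measurableSet_Ioi)
  have hy'meas2 : MeasureTheory.AEStronglyMeasurable (fun u => y' (t - u))
      MeasureTheory.volume :=
    hy'meas.comp_measurePreserving
      (MeasureTheory.Measure.measurePreserving_sub_left MeasureTheory.volume t)
  have hpmeas : Measurable fun u : ℝ => u ^ p := by fun_prop
  have main := intervalIntegral.hasDerivAt_integral_of_dominated_loc_of_lip
    (μ := MeasureTheory.volume) (a := 0) (b := T) (x₀ := t) (s := Metric.ball t 1)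
    (F := fun s u => u ^ p • y (s - u)) (F' := fun u => u ^ p • y' (t - u))
    (bound := fun u => u ^ p * C)
    (Metric.ball_mem_nhds t one_pos)
    (Eventually.of_forall fun s => (intervalIntegrable_iff.1 (hyi s)).aestronglyMeasurable)
    (hyi t)
    ((hpmeas.aestronglyMeasurable.smul hy'meas2).restrict)
    (Eventually.of_forall fun u hu => by
      rw [uIoc_of_le (by linarith)] at hu
      refine LipschitzOnWith.of_dist_le_mul fun a ha b hb => ?_
      have hup : 0 ≤ u ^ p := Real.rpow_nonneg hu.1.le _
      rw [Metric.mem_ball, Real.dist_eq] at ha hb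
      have ha' := (abs_lt.1 ha).2
      have hb' := (abs_lt.1 hb).2
      have h := hylip (a - u) (by linarith [hu.1]) (b - u) (by linarith [hu.1])
      rw [show a - u - (b - u) = a - b by ring] at h
      simp only [dist_eq_norm, Real.coe_nnabs]
      rw [← smul_sub, norm_smul, Real.norm_of_nonneg hup,
        abs_of_nonneg (mul_nonneg hup hC0), mul_assoc]
      gcongr)
    (hint.mul_const C)
    (by
      filter_upwards [hae] with u hu _
      have h := hyder (t - u) (sub_ne_zero.2 (Ne.symm hu))
      exact (h.comp_sub_const t u).const_smul (u ^ p))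
  obtain ⟨hi', hder⟩ := main
  have hval := hconv t ⟨ht, by linarith⟩ y' x' (fun r hr => by simp [hy', hr])
    (fun r hr => by simp [hy', hr]) hi'
  unfold HasCaputoDerivAt HasRLDerivAt rlIntegral
  rw [← hpdef, hval]
  refine (hder.const_smul (1 / Real.Gamma (1 - α))).congr_of_eventuallyEq ?_
  filter_upwards [Ioo_mem_nhds ht (show t < T by linarith)] with s hs
  rw [hconv s hs y (fun r => x r - x 0) (fun r hr => by simp [hy, max_eq_left (le_of_lt hr)])
    (fun r hr => by simp [hy, max_eq_right hr]) (hyi s)]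
  rfl

end

end FractionalPerron

namespace FractionalPerron

open MeasureTheory

noncomputable section

/-! Let `g = f + λx₀` and `z = x - x₀`. Formally, the Laplace transform turns the equation into
`(p^α - λ) ẑ = ĝ`, so `x = x₀ + r * g`, where the resolvent `r` has transform `(p^α - λ)⁻¹`.
Everything rests on `r` being integrable. Then `r * g` is bounded because `g` is. If `f → 0`, then
`g → λx₀`, and `∫ r`, the value of the transform at `p = 0`, is `-λ⁻¹`, so `x → x₀ - λ⁻¹λx₀ = 0`.
This deduction is `stability_of_resolvent`.

The formula for `x` is `IsSolution.eq_add_conv`. No growth of `x` is known in advance, so one works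
with `Z = ∫ z`. It solves a Volterra equation with weakly singular kernel, hence grows at most
exponentially (`exists_expBounded_of_volterra`). Lerch's theorem (`ExpBounded.eq_zero_of_laplace`)
then identifies `Z` with `∫ (r * g)`.

The sector condition enters in `exists_resolvent`. It allows an angle `θ > π/2` with `αθ < |arg λ|`,
so `s^α - λ` has no zero in `|arg s| ≤ θ`, while `e^{st}` decays on the rays `arg s = ±θ`. The
inverse Laplace integral over these rays defines `r`, after a correction making the symbol vanish at
`s = 0`. In the variable `log s` the rays become the two edges of a horizontal strip, and Cauchy's
formula there (`integral_strip_eq`) computes the transform. -/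

/-! ### Convolution and the Laplace transform. -/

/-- The one-sided convolution `∫₀ˣ a(t) b(x - t) dt`. -/
def conv (a b : ℝ → ℂ) (x : ℝ) : ℂ := ∫ t in (0 : ℝ)..x, a t * b (x - t)

/-- The Laplace transform. -/
def laplace (a : ℝ → ℂ) (p : ℂ) : ℂ := ∫ t in Ioi (0 : ℝ), Complex.exp (-p * t) * a t

/-- Absolute convergence of the Laplace integral. -/
def LaplaceConv (a : ℝ → ℂ) (p : ℂ) : Prop :=
  IntegrableOn (fun t : ℝ => Complex.exp (-p * t) * a t) (Ioi 0)

/-- Continuous functions on `[0, ∞)` of exponential growth at most `exp (σ t)`. -/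
def ExpBounded (σ : ℝ) (b : ℝ → ℂ) : Prop :=
  ContinuousOn b (Ici 0) ∧ ∃ C, ∀ t, 0 ≤ t → ‖b t‖ ≤ C * Real.exp (σ * t)

lemma norm_exp_neg_mul (p : ℂ) (t : ℝ) :
    ‖Complex.exp (-p * t)‖ = Real.exp (-p.re * t) := by
  rw [Complex.norm_exp]; simp

lemma LaplaceConv.mono {a : ℝ → ℂ} {p q : ℂ} (h : LaplaceConv a p) (hpq : p.re ≤ q.re) :
    LaplaceConv a q := by
  have h1 := Integrable.bdd_mul (c := 1) h
    (f := fun t : ℝ => Complex.exp (-(q - p) * t)) (by fun_prop) (by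
      filter_upwards [ae_restrict_mem measurableSet_Ioi] with t ht
      rw [norm_exp_neg_mul, Real.exp_le_one_iff]
      have : 0 < t := ht
      simp only [Complex.sub_re]
      nlinarith)
  refine h1.congr (Eventually.of_forall fun t => ?_)
  simp only
  rw [← mul_assoc, ← Complex.exp_add]
  ring_nf

lemma LaplaceConv.add {a b : ℝ → ℂ} {p : ℂ} (ha : LaplaceConv a p) (hb : LaplaceConv b p) :
    LaplaceConv (fun t => a t + b t) p := by
  refine (Integrable.add ha hb).congr (Eventually.of_forall fun t => ?_)
  simp [mul_add]

lemma laplace_add {a b : ℝ → ℂ} {p : ℂ} (ha : LaplaceConv a p) (hb : LaplaceConv b p) :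
    laplace (fun t => a t + b t) p = laplace a p + laplace b p := by
  unfold laplace
  simp only [mul_add]
  exact integral_add ha hb

lemma laplace_const_mul (a : ℝ → ℂ) (c p : ℂ) :
    laplace (fun t => c * a t) p = c * laplace a p := by
  unfold laplace
  rw [← integral_const_mul]
  congr 1; ext t; ring

lemma laplace_congr {a b : ℝ → ℂ} (h : ∀ t, 0 < t → a t = b t) (p : ℂ) :
    laplace a p = laplace b p :=
  setIntegral_congr_fun measurableSet_Ioi fun t ht => by simp only [h t ht]

lemma conv_congr {a b b' : ℝ → ℂ} {x : ℝ} (hx : 0 ≤ x) (h : ∀ t ∈ Icc 0 x, b t = b' t) :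
    conv a b x = conv a b' x := by
  refine intervalIntegral.integral_congr fun t ht => ?_
  rw [uIcc_of_le hx] at ht
  simp only [h (x - t) ⟨by linarith [ht.2], by linarith [ht.1]⟩]

lemma conv_one_left (b : ℝ → ℂ) (x : ℝ) : conv (fun _ => 1) b x = ∫ t in (0 : ℝ)..x, b t := by
  unfold conv
  simp only [one_mul]
  rw [intervalIntegral.integral_comp_sub_left (fun t => b t) x]
  simp

lemma LaplaceConv.intervalIntegrable {a : ℝ → ℂ} {p : ℂ} (h : LaplaceConv a p) {x : ℝ}
    (hx : 0 ≤ x) : IntervalIntegrable a volume 0 x := by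
  have h1 : IntervalIntegrable (fun t : ℝ => Complex.exp (-p * t) * a t) volume 0 x :=
    (intervalIntegrable_iff_integrableOn_Ioc_of_le hx).2 (h.mono_set Ioc_subset_Ioi_self)
  have hc : ContinuousOn (fun t : ℝ => Complex.exp (p * t)) (uIcc 0 x) := by fun_prop
  have h2 := h1.continuousOn_mul hc
  refine h2.congr fun t _ => ?_
  rw [← mul_assoc, ← Complex.exp_add]
  simp

lemma ExpBounded.laplaceConv {σ : ℝ} {b : ℝ → ℂ} (hb : ExpBounded σ b) {p : ℂ} (hp : σ < p.re) :
    LaplaceConv b p := by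
  obtain ⟨hc, C, hC⟩ := hb
  have h1 : IntegrableOn (fun t : ℝ => C * Real.exp ((σ - p.re) * t)) (Ioi 0) :=
    (integrableOn_exp_mul_Ioi (by linarith) 0).const_mul C
  refine Integrable.mono' h1 ?_ ?_
  · refine AEStronglyMeasurable.mul (by fun_prop) ?_
    exact (hc.mono Ioi_subset_Ici_self).aestronglyMeasurable measurableSet_Ioi
  · filter_upwards [ae_restrict_mem measurableSet_Ioi] with t ht
    rw [norm_mul, norm_exp_neg_mul]
    calc _ ≤ Real.exp (-p.re * t) * (C * Real.exp (σ * t)) := by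
          gcongr; exact hC t (le_of_lt ht)
      _ = _ := by
          rw [show (σ - p.re) * t = -p.re * t + σ * t by ring, Real.exp_add]; ring

lemma ExpBounded.add {σ : ℝ} {a b : ℝ → ℂ} (ha : ExpBounded σ a) (hb : ExpBounded σ b) :
    ExpBounded σ (fun t => a t + b t) := by
  obtain ⟨h1, C, hC⟩ := ha
  obtain ⟨h2, D, hD⟩ := hb
  refine ⟨h1.add h2, C + D, fun t ht => ?_⟩
  rw [add_mul]
  exact (norm_add_le _ _).trans (add_le_add (hC t ht) (hD t ht))

lemma ExpBounded.const_mul {σ : ℝ} {a : ℝ → ℂ} (ha : ExpBounded σ a) (c : ℂ) :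
    ExpBounded σ (fun t => c * a t) := by
  obtain ⟨h1, C, hC⟩ := ha
  refine ⟨h1.const_smul c, ‖c‖ * C, fun t ht => ?_⟩
  rw [norm_mul, mul_assoc]
  gcongr
  exact hC t ht

lemma ExpBounded.mono {σ τ : ℝ} {a : ℝ → ℂ} (ha : ExpBounded σ a) (h : σ ≤ τ) :
    ExpBounded τ a := by
  obtain ⟨h1, C, hC⟩ := ha
  have hC0 : 0 ≤ C := by simpa using (norm_nonneg _).trans (hC 0 le_rfl)
  refine ⟨h1, C, fun t ht => (hC t ht).trans ?_⟩
  gcongr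

lemma continuousOn_conv {a b : ℝ → ℂ} (ha : ∀ x, 0 ≤ x → IntervalIntegrable a volume 0 x)
    (hb : ContinuousOn b (Ici 0)) : ContinuousOn (conv a b) (Ici 0) := by
  intro x₀ hx₀
  have hx₀' : (0 : ℝ) ≤ x₀ := hx₀
  set X := x₀ + 1 with hX
  have hX0 : 0 ≤ X := by linarith
  -- Extension by zero replaces the moving domain `[0, x]` by the fixed domain `[0, X]`, so
  -- dominated convergence applies. The extension may jump at `0`, which affects only `t = x₀`, a
  -- null set.
  set b' : ℝ → ℂ := (Ici 0).indicator b with hb'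
  have hbm : AEStronglyMeasurable b' volume :=
    (aestronglyMeasurable_indicator_iff measurableSet_Ici).2
      (hb.aestronglyMeasurable measurableSet_Ici)
  obtain ⟨B, hB⟩ : ∃ B, ∀ s ∈ Icc 0 X, ‖b s‖ ≤ B :=
    isCompact_Icc.exists_bound_of_continuousOn (hb.mono Icc_subset_Ici_self)
  have hB0 : 0 ≤ B := (norm_nonneg _).trans (hB 0 ⟨le_rfl, hX0⟩)
  have hb'B : ∀ s ≤ X, ‖b' s‖ ≤ B := by
    intro s hs
    by_cases h : 0 ≤ s
    · simpa [hb', h] using hB s ⟨h, hs⟩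
    · simpa [hb', h] using hB0
  have hae : ∀ᵐ u : ℝ, u ≠ x₀ := by
    simp [ae_iff, measure_singleton]
  have hmeas : ∀ x, AEStronglyMeasurable (fun t => a t * b' (x - t))
      (volume.restrict (uIoc 0 X)) := fun x =>
    ((ha X hX0).aestronglyMeasurable_restrict_uIoc).mul
      (hbm.comp_measurePreserving (Measure.measurePreserving_sub_left volume x)).restrict
  have hbd : ∀ x ≤ X, ∀ t ∈ uIoc 0 X, ‖a t * b' (x - t)‖ ≤ ‖a t‖ * B := by
    intro x hx t ht
    rw [uIoc_of_le hX0] at ht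
    rw [norm_mul]
    gcongr
    exact hb'B _ (by linarith [ht.1])
  have key : ContinuousWithinAt (fun x => ∫ t in (0 : ℝ)..X, a t * b' (x - t)) (Ici 0) x₀ := by
    refine (intervalIntegral.continuousAt_of_dominated_interval (bound := fun t => ‖a t‖ * B)
      (Eventually.of_forall hmeas) ?_ ((ha X hX0).norm.mul_const B) ?_).continuousWithinAt
    · filter_upwards [Iio_mem_nhds (show x₀ < X by linarith)] with x hx
      exact Eventually.of_forall fun t ht => hbd x (le_of_lt hx) t ht
    · filter_upwards [hae] with t ht _
      have hne : x₀ - t ≠ 0 := sub_ne_zero.2 ht.symm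
      have hcb : ContinuousAt b' (x₀ - t) := by
        rcases lt_or_gt_of_ne hne with h | h
        · refine (continuousAt_const (y := (0 : ℂ))).congr ?_
          filter_upwards [Iio_mem_nhds h] with s hs
          simp [hb', not_le.2 (mem_Iio.1 hs)]
        · refine ((hb _ h.le).continuousAt (Ici_mem_nhds h)).congr ?_
          filter_upwards [Ioi_mem_nhds h] with s hs
          simp [hb', le_of_lt (mem_Ioi.1 hs)]
      have : ContinuousAt (fun x => b' (x - t)) x₀ :=
        ContinuousAt.comp (f := fun x : ℝ => x - t) (x := x₀) hcb (by fun_prop)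
      exact continuousAt_const.mul this
  have heq : ∀ x ∈ Icc 0 X, conv a b x = ∫ t in (0 : ℝ)..X, a t * b' (x - t) := by
    intro x hx
    have hi : IntervalIntegrable (fun t => a t * b' (x - t)) volume 0 X := by
      refine ((ha X hX0).norm.mul_const B).mono_fun (hmeas x) ?_
      filter_upwards [ae_restrict_mem measurableSet_uIoc] with t ht
      rw [norm_mul (‖a t‖) B, norm_norm, Real.norm_of_nonneg hB0]
      exact hbd x hx.2 t ht
    have hxX : x ∈ uIcc 0 X := by rwa [uIcc_of_le hX0]
    rw [← intervalIntegral.integral_add_adjacent_intervals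
      (hi.mono_set (uIcc_subset_uIcc left_mem_uIcc hxX))
      (hi.mono_set (uIcc_subset_uIcc hxX right_mem_uIcc))]
    have h2 : (∫ t in x..X, a t * b' (x - t)) = 0 := by
      refine intervalIntegral.integral_zero_ae (Eventually.of_forall fun t ht => ?_)
      rw [uIoc_of_le hx.2] at ht
      have : ¬ (0 ≤ x - t) := by linarith [ht.1]
      simp [hb', ht.1]
    rw [h2, add_zero]
    refine intervalIntegral.integral_congr fun t ht => ?_
    rw [uIcc_of_le hx.1] at ht
    have : t ≤ x := ht.2
    simp [hb', this]
  refine key.congr_of_eventuallyEq ?_ (heq x₀ ⟨hx₀', by linarith⟩)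
  filter_upwards [self_mem_nhdsWithin, mem_nhdsWithin_of_mem_nhds
    (Iio_mem_nhds (show x₀ < X by linarith))] with x hx hx'
  exact heq x ⟨hx, le_of_lt hx'⟩

/-- Since `e^{σx} = e^{σt} e^{σ(x-t)}`, this is Young's inequality in weighted spaces. The explicit
constant and the use of `b` on `[0, x]` only are what the growth estimate for the Volterra equation
needs. -/
lemma norm_conv_le {σ C x : ℝ} {a b : ℝ → ℂ} (ha : LaplaceConv a σ) (hx : 0 ≤ x)
    (hb : ∀ t ∈ Icc 0 x, ‖b t‖ ≤ C * Real.exp (σ * t)) :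
    ‖conv a b x‖ ≤ C * (∫ t in Ioi (0 : ℝ), ‖Complex.exp (-(σ : ℂ) * t) * a t‖) *
      Real.exp (σ * x) := by
  have hC0 : 0 ≤ C := by simpa using (norm_nonneg _).trans (hb 0 ⟨le_rfl, hx⟩)
  have hint : IntervalIntegrable (fun t : ℝ => ‖Complex.exp (-(σ : ℂ) * t) * a t‖) volume 0 x :=
    (intervalIntegrable_iff_integrableOn_Ioc_of_le hx).2
      ((Integrable.norm ha).mono_measure (Measure.restrict_mono Ioc_subset_Ioi_self le_rfl))
  calc ‖conv a b x‖ ≤ ∫ t in (0 : ℝ)..x,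
        C * Real.exp (σ * x) * ‖Complex.exp (-(σ : ℂ) * t) * a t‖ := by
        refine intervalIntegral.norm_integral_le_of_norm_le hx
          (Eventually.of_forall fun t ht => ?_) (hint.const_mul _)
        rw [norm_mul, norm_mul, norm_exp_neg_mul]
        have h1 := hb (x - t) ⟨by linarith [ht.2], by linarith [ht.1]⟩
        calc ‖a t‖ * ‖b (x - t)‖ ≤ ‖a t‖ * (C * Real.exp (σ * (x - t))) := by gcongr
          _ = _ := by
            rw [show σ * (x - t) = σ * x + -σ * t by ring, Real.exp_add, Complex.ofReal_re]
            ring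
    _ = C * Real.exp (σ * x) * ∫ t in Ioc (0 : ℝ) x, ‖Complex.exp (-(σ : ℂ) * t) * a t‖ := by
        rw [intervalIntegral.integral_const_mul, intervalIntegral.integral_of_le hx]
    _ ≤ C * Real.exp (σ * x) * ∫ t in Ioi (0 : ℝ), ‖Complex.exp (-(σ : ℂ) * t) * a t‖ := by
        refine mul_le_mul_of_nonneg_left ?_ (by positivity)
        exact setIntegral_mono_set (Integrable.norm ha)
          (Eventually.of_forall fun t => norm_nonneg _)
          (Eventually.of_forall fun _ h => Ioc_subset_Ioi_self h)
    _ = _ := by ring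

lemma ExpBounded.conv {σ : ℝ} {a b : ℝ → ℂ} (ha : LaplaceConv a σ) (hb : ExpBounded σ b) :
    ExpBounded σ (conv a b) := by
  obtain ⟨hc, C, hC⟩ := hb
  exact ⟨continuousOn_conv (fun x hx => ha.intervalIntegrable hx) hc,
    _, fun t ht => norm_conv_le ha ht fun s hs => hC s hs.1⟩

/-- The weight `e^{-px}` splits over `x = t + (x - t)`, which reduces this to the integral of a
convolution of two integrable functions. -/
lemma laplace_conv {a b : ℝ → ℂ} {p : ℂ} (ha : LaplaceConv a p) (hb : LaplaceConv b p) :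
    laplace (conv a b) p = laplace a p * laplace b p := by
  have h := integral_posConvolution ha hb (ContinuousLinearMap.mul ℝ ℂ)
  simp only [ContinuousLinearMap.mul_apply'] at h
  unfold laplace
  rw [← h]
  congr 1
  ext x
  unfold FractionalPerron.conv
  rw [← intervalIntegral.integral_const_mul]
  congr 1
  ext t
  rw [show -p * (x : ℂ) = -p * t + -p * ((x - t : ℝ) : ℂ) by push_cast; ring, Complex.exp_add]
  ring

/-! ### Analyticity and injectivity of the Laplace transform. -/

lemma ExpBounded.differentiableAt_laplace {σ : ℝ} {b : ℝ → ℂ} (hb : ExpBounded σ b) {p : ℂ}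
    (hp : σ < p.re) : DifferentiableAt ℂ (laplace b) p := by
  obtain ⟨hc, C, hC⟩ := id hb
  -- Half the distance to the line `Re = σ`: on the ball of radius `δ` the differentiated integrand
  -- is dominated by `C t e^{-δt}`.
  set δ := (p.re - σ) / 2 with hδ
  have hδ0 : 0 < δ := by rw [hδ]; linarith
  have hC0 : 0 ≤ C := by simpa using (norm_nonneg _).trans (hC 0 le_rfl)
  have hbm : AEStronglyMeasurable b (volume.restrict (Ioi 0)) :=
    (hc.mono Ioi_subset_Ici_self).aestronglyMeasurable measurableSet_Ioi
  have hbound : IntegrableOn (fun t : ℝ => C * (t ^ (1 : ℝ) * Real.exp (-δ * t ^ (1 : ℝ))))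
      (Ioi 0) :=
    (integrableOn_rpow_mul_exp_neg_mul_rpow (by norm_num) one_pos hδ0).const_mul C
  have := hasDerivAt_integral_of_dominated_loc_of_deriv_le (μ := volume.restrict (Ioi (0 : ℝ)))
    (F := fun (q : ℂ) (t : ℝ) => Complex.exp (-q * t) * b t)
    (F' := fun (q : ℂ) (t : ℝ) => Complex.exp (-q * t) * (-1 * t) * b t)
    (x₀ := p) (bound := fun t : ℝ => C * (t ^ (1 : ℝ) * Real.exp (-δ * t ^ (1 : ℝ))))
    (Metric.ball_mem_nhds p hδ0)
    (Eventually.of_forall fun q => AEStronglyMeasurable.mul (by fun_prop) hbm)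
    (hb.laplaceConv hp)
    (AEStronglyMeasurable.mul (by fun_prop) hbm)
    (by
      filter_upwards [ae_restrict_mem measurableSet_Ioi] with t ht q hq
      have ht0 : 0 < t := ht
      have h1 : |(q - p).re| < δ :=
        (Complex.abs_re_le_norm _).trans_lt (by simpa [dist_eq_norm] using hq)
      have h2 := (abs_lt.1 h1).1
      rw [Complex.sub_re] at h2
      rw [norm_mul, norm_mul, norm_exp_neg_mul, norm_mul, norm_neg, norm_one, one_mul,
        Complex.norm_of_nonneg ht0.le, Real.rpow_one]
      calc _ ≤ Real.exp (-q.re * t) * t * (C * Real.exp (σ * t)) := by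
            gcongr; exact hC t ht0.le
        _ = C * (t * Real.exp (-q.re * t + σ * t)) := by rw [Real.exp_add]; ring
        _ ≤ _ := by
            gcongr
            nlinarith)
    hbound
    (Eventually.of_forall fun t q _ => by
      have h1 : HasDerivAt (fun q : ℂ => -q * (t : ℂ)) (-1 * (t : ℂ)) q :=
        ((hasDerivAt_id q).neg).mul_const _
      exact (h1.cexp).mul_const (b t))
  exact this.2.differentiableAt

/-- Lerch's theorem: a continuous function of exponential growth is determined by the values of its
Laplace transform at large real arguments. -/
theorem ExpBounded.eq_zero_of_laplace {σ : ℝ} {b : ℝ → ℂ} (hb : ExpBounded σ b)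
    (h : ∀ p : ℝ, σ < p → laplace b p = 0) : ∀ t, 0 ≤ t → b t = 0 := by
  have hU : IsOpen {p : ℂ | σ < p.re} := isOpen_lt continuous_const Complex.continuous_re
  have hUc : IsPreconnected {p : ℂ | σ < p.re} := (convex_halfSpace_re_gt σ).isPreconnected
  have han : AnalyticOnNhd ℂ (laplace b) {p : ℂ | σ < p.re} :=
    DifferentiableOn.analyticOnNhd
      (fun p hp => (hb.differentiableAt_laplace hp).differentiableWithinAt) hU
  -- Identity theorem: the real zeros `σ + 1 + 1/(n + 1)` accumulate at the interior point `σ + 1`.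
  have hzero : EqOn (laplace b) 0 {p : ℂ | σ < p.re} := by
    refine han.eqOn_zero_of_preconnected_of_frequently_eq_zero hUc
      (z₀ := ((σ + 1 : ℝ) : ℂ)) (by simp) ?_
    have ht : Tendsto (fun n : ℕ => ((σ + 1 + 1 / ((n : ℝ) + 1) : ℝ) : ℂ)) atTop
        (𝓝[≠] ((σ + 1 : ℝ) : ℂ)) := by
      refine tendsto_nhdsWithin_iff.2 ⟨?_, Eventually.of_forall fun n => ?_⟩
      · refine (Complex.continuous_ofReal.tendsto _).comp ?_
        simpa using (tendsto_const_nhds (x := σ + 1)).add tendsto_one_div_add_atTop_nhds_zero_nat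
      · have : (0 : ℝ) < 1 / ((n : ℝ) + 1) := by positivity
        simp only [mem_compl_iff, mem_singleton_iff, Complex.ofReal_inj]
        linarith
    refine ht.frequently (Frequently.of_forall fun n => h _ ?_)
    have : (0 : ℝ) < 1 / ((n : ℝ) + 1) := by positivity
    linarith
  -- The Fourier transform of `H` is the Laplace transform of `b` on the line `Re = σ + 1`, hence
  -- zero. Fourier inversion at the points of continuity `t > 0` then gives `b t = 0`.
  set H : ℝ → ℂ := (Ioi 0).indicator fun t : ℝ => Complex.exp (-((σ + 1 : ℝ) : ℂ) * t) * b t with hH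
  have hHi : Integrable H :=
    (integrable_indicator_iff measurableSet_Ioi).2 (hb.laplaceConv (by simp))
  have hF : FourierTransform.fourier H = 0 := by
    ext w
    rw [Real.fourier_real_eq_integral_exp_smul]
    have h1 := hzero (x := ((σ + 1 : ℝ) : ℂ) + (2 * Real.pi * w : ℝ) * Complex.I) (by simp)
    simp only [laplace, Pi.zero_apply] at h1 ⊢
    rw [← h1, ← integral_indicator measurableSet_Ioi]
    congr 1
    ext t
    by_cases ht : t ∈ Ioi (0 : ℝ)
    · simp only [hH, indicator_of_mem ht, smul_eq_mul]
      rw [← mul_assoc, ← Complex.exp_add]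
      congr 2
      push_cast
      ring
    · simp [hH, indicator_of_notMem ht]
  have hpos : ∀ t, 0 < t → b t = 0 := by
    intro t ht
    have hca : ContinuousAt H t := by
      have h2 : ContinuousAt (fun t : ℝ => Complex.exp (-((σ + 1 : ℝ) : ℂ) * t) * b t) t :=
        ContinuousAt.mul (by fun_prop) ((hb.1 t ht.le).continuousAt (Ici_mem_nhds ht))
      refine h2.congr ?_
      filter_upwards [Ioi_mem_nhds ht] with s hs
      simp only [hH, indicator_of_mem hs]
    have h3 := hHi.fourierInv_fourier_eq (by rw [hF]; exact integrable_zero _ _ _) hca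
    rw [hF] at h3
    have h4 : FourierTransformInv.fourierInv (0 : ℝ → ℂ) t = 0 := by
      rw [Real.fourierInv_eq]; simp
    rw [h4] at h3
    simp only [hH, indicator_of_mem (show t ∈ Ioi (0 : ℝ) from ht)] at h3
    exact (mul_eq_zero.1 h3.symm).resolve_left (Complex.exp_ne_zero _)
  intro t ht
  have hcl : EqOn b (fun _ => 0) (closure (Ioi 0)) :=
    EqOn.of_subset_closure (s := Ioi 0) (fun s hs => hpos s hs)
      (by rw [closure_Ioi]; exact hb.1) continuousOn_const subset_closure subset_rfl
  exact hcl (by rw [closure_Ioi]; exact ht)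

theorem ExpBounded.eq_of_laplace_eq {σ : ℝ} {a b : ℝ → ℂ} (ha : ExpBounded σ a)
    (hb : ExpBounded σ b) (h : ∀ p : ℝ, σ < p → laplace a p = laplace b p) :
    ∀ t, 0 ≤ t → a t = b t := by
  intro t ht
  have hn := hb.const_mul (-1)
  have h0 := (ha.add hn).eq_zero_of_laplace (fun p hp => by
    rw [laplace_add (ha.laplaceConv (by simpa using hp)) (hn.laplaceConv (by simpa using hp)),
      laplace_const_mul, h p hp]
    ring) t ht
  linear_combination h0

/-! ### The Riemann-Liouville kernel and its transform `p^{-β}`. -/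

/-- The Riemann-Liouville kernel `t ^ (β - 1) / Γ(β)`. -/
def rlKernel (β t : ℝ) : ℂ := ((t ^ (β - 1) / Real.Gamma β : ℝ) : ℂ)

lemma rlKernel_one : rlKernel 1 = fun _ => 1 := by
  ext t; simp [rlKernel]

lemma rlIntegral_eq_conv (β : ℝ) (x : ℝ → ℂ) (t : ℝ) :
    rlIntegral β x t = conv (rlKernel β) x t := by
  unfold rlIntegral conv rlKernel
  rw [← intervalIntegral.integral_smul]
  have h := intervalIntegral.integral_comp_sub_left
    (fun s : ℝ => ((s ^ (β - 1) / Real.Gamma β : ℝ) : ℂ) * x (t - s)) t (a := 0) (b := t)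
  simp only [sub_self, sub_zero, sub_sub_cancel] at h
  rw [← h]
  congr 1
  ext s
  simp only [Complex.real_smul]
  push_cast
  ring

lemma integrableOn_exp_mul_rlKernel {β p : ℝ} (hβ : 0 < β) (hp : 0 < p) :
    IntegrableOn (fun t : ℝ => Real.exp (-p * t) * (t ^ (β - 1) / Real.Gamma β)) (Ioi 0) := by
  have h := (integrableOn_rpow_mul_exp_neg_mul_rpow (s := β - 1) (by linarith) one_pos
    hp).div_const (Real.Gamma β)
  refine h.congr (Eventually.of_forall fun t => ?_)
  simp only [Real.rpow_one]
  ring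

lemma integral_exp_mul_rlKernel {β p : ℝ} (hβ : 0 < β) (hp : 0 < p) :
    ∫ t in Ioi (0 : ℝ), Real.exp (-p * t) * (t ^ (β - 1) / Real.Gamma β) = p ^ (-β) := by
  have h := Real.integral_rpow_mul_exp_neg_mul_Ioi hβ hp
  have hG := (Real.Gamma_pos_of_pos hβ).ne'
  have h2 : ∀ t : ℝ, Real.exp (-p * t) * (t ^ (β - 1) / Real.Gamma β) =
      (Real.Gamma β)⁻¹ * (t ^ (β - 1) * Real.exp (-(p * t))) := by
    intro t
    rw [neg_mul]
    ring
  simp only [h2]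
  rw [integral_const_mul, h, one_div, Real.inv_rpow hp.le, Real.rpow_neg hp.le]
  field_simp

lemma exp_mul_rlKernel (β p t : ℝ) : Complex.exp (-(p : ℂ) * t) * rlKernel β t =
    ((Real.exp (-p * t) * (t ^ (β - 1) / Real.Gamma β) : ℝ) : ℂ) := by
  unfold rlKernel
  push_cast
  rfl

lemma laplaceConv_rlKernel {β p : ℝ} (hβ : 0 < β) (hp : 0 < p) :
    LaplaceConv (rlKernel β) p := by
  unfold LaplaceConv
  simp only [exp_mul_rlKernel]
  exact (integrableOn_exp_mul_rlKernel hβ hp).ofReal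

lemma laplace_rlKernel {β p : ℝ} (hβ : 0 < β) (hp : 0 < p) :
    laplace (rlKernel β) p = ((p ^ (-β) : ℝ) : ℂ) := by
  unfold laplace
  simp only [exp_mul_rlKernel]
  rw [integral_complex_ofReal, integral_exp_mul_rlKernel hβ hp]

lemma integral_norm_rlKernel {β p : ℝ} (hβ : 0 < β) (hp : 0 < p) :
    ∫ t in Ioi (0 : ℝ), ‖Complex.exp (-(p : ℂ) * t) * rlKernel β t‖ = p ^ (-β) := by
  rw [← integral_exp_mul_rlKernel hβ hp]
  refine setIntegral_congr_fun measurableSet_Ioi fun t ht => ?_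
  have ht0 : 0 < t := ht
  have := Real.Gamma_pos_of_pos hβ
  simp only [exp_mul_rlKernel]
  rw [Complex.norm_of_nonneg (by positivity)]

/-- The semigroup property `I^α I^(1 - α) = I^1`. -/
lemma conv_rlKernel_conv_rlKernel {α : ℝ} (hα : α ∈ Ioo (0 : ℝ) 1) {z : ℝ → ℂ}
    (hz : ContinuousOn z (Ici 0)) {T : ℝ} (hT : 0 ≤ T) :
    conv (rlKernel α) (conv (rlKernel (1 - α)) z) T = conv (rlKernel 1) z T := by
  obtain ⟨h0, h1⟩ := hα
  -- A convolution at `T` sees only `[0, T]`, so `z` may be frozen after `T`. This makes it bounded,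
  -- and the identity follows from `p^{-α} p^{-(1-α)} = p^{-1}` by Lerch's theorem.
  set y : ℝ → ℂ := fun s => z (min s T) with hy
  have hyz : ∀ s ∈ Icc 0 T, z s = y s := fun s hs => by simp [hy, hs.2]
  have hye : ExpBounded 1 y := by
    refine ⟨hz.comp (by fun_prop) fun s hs => le_min hs hT, ?_⟩
    obtain ⟨C, hC⟩ := isCompact_Icc.exists_bound_of_continuousOn
      (hz.mono (Icc_subset_Ici_self : Icc 0 T ⊆ _))
    have hC0 : 0 ≤ C := (norm_nonneg _).trans (hC 0 ⟨le_rfl, hT⟩)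
    refine ⟨C, fun t ht => (hC (min t T) ⟨le_min ht hT, min_le_right _ _⟩).trans ?_⟩
    exact le_mul_of_one_le_right hC0 (Real.one_le_exp (by linarith))
  have hk : ∀ β > 0, LaplaceConv (rlKernel β) ((1 : ℝ) : ℂ) := fun β hβ =>
    laplaceConv_rlKernel hβ one_pos
  have e1 : ExpBounded 1 (conv (rlKernel (1 - α)) y) := hye.conv (hk _ (by linarith))
  have e2 : ExpBounded 1 (conv (rlKernel α) (conv (rlKernel (1 - α)) y)) := e1.conv (hk _ h0)
  have e3 : ExpBounded 1 (conv (rlKernel 1) y) := hye.conv (hk _ one_pos)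
  have key := e2.eq_of_laplace_eq e3 (fun p hp => by
    have hp0 : 0 < p := by linarith
    have hyp : LaplaceConv y p := hye.laplaceConv (by simpa using hp)
    rw [laplace_conv (laplaceConv_rlKernel h0 hp0) (e1.laplaceConv (by simpa using hp)),
      laplace_conv (laplaceConv_rlKernel (by linarith) hp0) hyp,
      laplace_conv (laplaceConv_rlKernel one_pos hp0) hyp, laplace_rlKernel h0 hp0,
      laplace_rlKernel (by linarith) hp0, laplace_rlKernel one_pos hp0, ← mul_assoc,
      ← Complex.ofReal_mul, ← Real.rpow_add hp0]
    congr 3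
    ring) T hT
  rw [conv_congr hT (fun s hs => conv_congr hs.1
    (fun u hu => hyz u ⟨hu.1, hu.2.trans hs.2⟩)), key]
  exact (conv_congr hT hyz).symm

/-! ### The Volterra equation and variation of constants. -/

/-- Solutions of the Volterra equation with Riemann-Liouville kernel grow at most
exponentially. -/
lemma exists_expBounded_of_volterra {α : ℝ} (hα : 0 < α) {c : ℂ} {Z G : ℝ → ℂ}
    (hZ : ContinuousOn Z (Ici 0)) (hG : ExpBounded 1 G)
    (h : ∀ t, 0 ≤ t → Z t = conv (rlKernel α) (fun s => c * Z s + G s) t) :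
    ∃ σ, 1 ≤ σ ∧ ExpBounded σ Z := by
  -- The kernel has mass `σ^{-α}` for the weight `e^{-σt}`. For large `σ` the weighted maximum `B`
  -- of `Z` on `[0, T]` satisfies `B ≤ B/2 + C`, so `B ≤ 2C` whatever `T` is.
  obtain ⟨σ, hσ1, hσ2, hσ3⟩ : ∃ σ : ℝ, 1 ≤ σ ∧ σ ^ (-α) ≤ 1 ∧ ‖c‖ * σ ^ (-α) ≤ 1 / 2 := by
    have h1 := tendsto_rpow_neg_atTop hα
    have h2 : Tendsto (fun σ : ℝ => ‖c‖ * σ ^ (-α)) atTop (𝓝 0) := by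
      simpa using h1.const_mul ‖c‖
    exact ((eventually_ge_atTop 1).and ((h1.eventually_le_const one_pos).and
      (h2.eventually_le_const (by norm_num)))).exists
  have hσ0 : 0 < σ := by linarith
  obtain ⟨-, C, hC⟩ := hG.mono hσ1
  have hC0 : 0 ≤ C := by simpa using (norm_nonneg _).trans (hC 0 le_rfl)
  refine ⟨σ, hσ1, hZ, 2 * C, fun T hT => ?_⟩
  obtain ⟨s, hs, hmax⟩ := isCompact_Icc.exists_isMaxOn (f := fun t => ‖Z t‖ * Real.exp (-(σ * t)))
    (nonempty_Icc.2 hT) ((hZ.mono Icc_subset_Ici_self).norm.mul (by fun_prop))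
  set B := ‖Z s‖ * Real.exp (-(σ * s)) with hB
  have hB0 : 0 ≤ B := by positivity
  have hle : ∀ t ∈ Icc 0 T, ‖Z t‖ ≤ B * Real.exp (σ * t) := by
    intro t ht
    have := hmax ht
    simp only [mem_ofPred_eq] at this
    rwa [Real.exp_neg, ← div_eq_mul_inv, div_le_iff₀ (Real.exp_pos _)] at this
  have h3 := norm_conv_le (C := ‖c‖ * B + C) (b := fun s => c * Z s + G s)
    (laplaceConv_rlKernel hα hσ0) hs.1 (fun t ht => by
      refine (norm_add_le _ _).trans ?_
      rw [norm_mul, add_mul, mul_assoc]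
      gcongr
      · exact hle t ⟨ht.1, ht.2.trans hs.2⟩
      · exact hC t ht.1)
  rw [← h s hs.1, integral_norm_rlKernel hα hσ0] at h3
  have h4 : B ≤ (‖c‖ * B + C) * σ ^ (-α) := by
    have hBs : B * Real.exp (σ * s) = ‖Z s‖ := by
      rw [hB, mul_assoc, ← Real.exp_add]
      simp
    rw [← hBs] at h3
    exact le_of_mul_le_mul_right h3 (Real.exp_pos _)
  have h5 : B ≤ 2 * C := by nlinarith
  exact (hle T ⟨hT, le_rfl⟩).trans (by gcongr)

lemma hasDerivAt_conv_one {z : ℝ → ℂ} (hz : ContinuousOn z (Ici 0)) {t : ℝ} (ht : 0 < t) :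
    HasDerivAt (conv (rlKernel 1) z) (z t) t := by
  rw [rlKernel_one, funext (conv_one_left z)]
  refine intervalIntegral.integral_hasDerivAt_right
    ((hz.mono (by rw [uIcc_of_le ht.le]; exact Icc_subset_Ici_self)).intervalIntegrable)
    ?_ ((hz t ht.le).continuousAt (Ici_mem_nhds ht))
  exact (hz.mono Ioi_subset_Ici_self).stronglyMeasurableAtFilter isOpen_Ioi t ht

/-- The variation of constants formula: solutions are given by convolution with the resolvent,
i.e. the function with Laplace transform `(p ^ α - lam)⁻¹`. -/
theorem IsSolution.eq_add_conv {α : ℝ} (hα : α ∈ Ioo (0 : ℝ) 1) {lam : ℂ}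
    (hne : ∀ p : ℝ, 0 < p → (p : ℂ) ≠ lam) {r : ℝ → ℂ} (hr : LaplaceConv r (0 : ℝ))
    (hrl : ∀ p : ℝ, 0 < p → laplace r p = (((p ^ α : ℝ) : ℂ) - lam)⁻¹) {f : ℝ → ℝ}
    (hf : f ∈ CInfty ℝ) {x₀ : ℂ} {x : ℝ → ℂ} (hx : IsSolution α lam f x₀ x) {t : ℝ}
    (ht : 0 < t) : x t = x₀ + conv r (fun s => (f s : ℂ) + lam * x₀) t := by
  obtain ⟨h0, h1⟩ := id hα
  obtain ⟨hfc, M, hM⟩ := hf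
  set g : ℝ → ℂ := fun s => (f s : ℂ) + lam * x₀ with hg
  set z : ℝ → ℂ := fun s => x s - x₀ with hz
  have hfc' : ContinuousOn (fun s => (f s : ℂ)) (Ici 0) :=
    Complex.continuous_ofReal.comp_continuousOn hfc
  have hzc : ContinuousOn z (Ici 0) := hx.continuousOn.sub continuousOn_const
  have hge : ExpBounded 0 g := by
    refine ⟨hfc'.add continuousOn_const, M + ‖lam * x₀‖, fun s hs => ?_⟩
    simp only [zero_mul, Real.exp_zero, mul_one]
    refine (norm_add_le _ _).trans (add_le_add_left ?_ _)
    simpa using hM s hs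
  have hk1 : LaplaceConv (rlKernel 1) ((1 : ℝ) : ℂ) := laplaceConv_rlKernel one_pos one_pos
  have hGe : ExpBounded 1 (conv (rlKernel 1) g) := (hge.mono zero_le_one).conv hk1
  have hki : ∀ β > 0, ∀ y, 0 ≤ y → IntervalIntegrable (rlKernel β) volume 0 y := fun β hβ y hy =>
    (laplaceConv_rlKernel hβ one_pos).intervalIntegrable hy
  have hii : ∀ {u : ℝ → ℂ}, ContinuousOn u (Ici 0) → ∀ {s : ℝ}, 0 ≤ s →
      IntervalIntegrable u volume 0 s := fun hu s hs =>
    (hu.mono (by rw [uIcc_of_le hs]; exact Icc_subset_Ici_self)).intervalIntegrable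
  -- The equation integrated from `0`. There is no integration constant, as `I^{1-α} z` is
  -- continuous up to `0` and vanishes there.
  have hw : ∀ s, 0 ≤ s → conv (rlKernel (1 - α)) z s =
      lam * conv (rlKernel 1) z s + conv (rlKernel 1) g s := by
    intro s hs
    have hcont := (continuousOn_conv (hki (1 - α) (by linarith)) hzc).mono
      (Icc_subset_Ici_self : Icc 0 s ⊆ _)
    have hh : ContinuousOn (fun u => lam * x u + (f u : ℂ)) (Ici 0) :=
      (hx.continuousOn.const_smul lam).add hfc'
    have hftc := intervalIntegral.integral_eq_sub_of_hasDeriv_right_of_le hs hcont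
      (f' := fun u => lam * x u + (f u : ℂ)) (fun u hu => by
        have h := hx.equation u hu.1
        unfold HasCaputoDerivAt HasRLDerivAt at h
        rw [hx.initial, funext (rlIntegral_eq_conv (1 - α) _)] at h
        exact h.hasDerivWithinAt) (hii hh hs)
    have hw0 : conv (rlKernel (1 - α)) z 0 = 0 := by simp [conv]
    rw [hw0, sub_zero] at hftc
    rw [← hftc, rlKernel_one, conv_one_left, conv_one_left, ← intervalIntegral.integral_const_mul,
      ← intervalIntegral.integral_add ((hii hzc hs).const_mul lam) (hii hge.1 hs)]
    congr 1
    ext u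
    simp only [hz, hg]
    ring
  have hZc : ContinuousOn (conv (rlKernel 1) z) (Ici 0) := continuousOn_conv (hki 1 one_pos) hzc
  -- Apply `I^α` to the integrated equation and use `I^α I^{1-α} = I^1`.
  have hvol : ∀ s, 0 ≤ s → conv (rlKernel 1) z s =
      conv (rlKernel α) (fun u => lam * conv (rlKernel 1) z u + conv (rlKernel 1) g u) s := by
    intro s hs
    rw [← conv_rlKernel_conv_rlKernel hα hzc hs]
    exact conv_congr hs fun u hu => hw u hu.1
  obtain ⟨σ, hσ, hZe⟩ := exists_expBounded_of_volterra h0 hZc hGe hvol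
  have hrg : ExpBounded 0 (conv r g) := hge.conv hr
  have hVe : ExpBounded σ (conv (rlKernel 1) (conv r g)) :=
    ((hrg.mono zero_le_one).conv hk1).mono hσ
  have key := hZe.eq_of_laplace_eq hVe (fun p hp => by
    have hp0 : 0 < p := by linarith
    have hZp : LaplaceConv (conv (rlKernel 1) z) p := hZe.laplaceConv (by simpa using hp)
    have hGp : LaplaceConv (conv (rlKernel 1) g) p :=
      hGe.laplaceConv (by rw [Complex.ofReal_re]; linarith)
    have hgp : LaplaceConv g p := hge.laplaceConv (by rw [Complex.ofReal_re]; linarith)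
    have hLp : LaplaceConv (fun u => lam * conv (rlKernel 1) z u) p :=
      (hZe.const_mul lam).laplaceConv (by simpa using hp)
    have e1 : laplace (conv (rlKernel 1) z) p =
        ((p ^ (-α) : ℝ) : ℂ) * (lam * laplace (conv (rlKernel 1) z) p +
          laplace (conv (rlKernel 1) g) p) := by
      conv_lhs => rw [laplace_congr (fun s hs => hvol s hs.le)]
      rw [laplace_conv (laplaceConv_rlKernel h0 hp0) (hLp.add hGp), laplace_rlKernel h0 hp0,
        laplace_add hLp hGp, laplace_const_mul]
    have hk1p := laplaceConv_rlKernel one_pos hp0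
    rw [laplace_conv hk1p hgp] at e1
    rw [laplace_conv hk1p (hrg.laplaceConv (by simpa using hp0)),
      laplace_conv (hr.mono (by simpa using hp0.le)) hgp, hrl p hp0]
    have hpp : 0 < p ^ α := Real.rpow_pos_of_pos hp0 α
    have hpne : ((p ^ α : ℝ) : ℂ) ≠ 0 := by exact_mod_cast hpp.ne'
    have hsub : ((p ^ α : ℝ) : ℂ) - lam ≠ 0 := sub_ne_zero.2 (hne _ hpp)
    rw [Real.rpow_neg hp0.le, Complex.ofReal_inv] at e1
    field_simp at e1 ⊢
    linear_combination e1)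
  -- The antiderivatives of `z` and `r * g` agree on `(0, ∞)`; differentiating them recovers `z = r
  -- * g`.
  have hd1 := hasDerivAt_conv_one hzc ht
  have hd2 := hasDerivAt_conv_one hrg.1 ht
  have := hd1.unique (hd2.congr_of_eventuallyEq (by
    filter_upwards [Ioi_mem_nhds ht] with s hs
    exact key s (le_of_lt hs)))
  rw [← this, hz]
  ring

/-! ### Asymptotics from an integrable resolvent. -/

/-- Convolution with an integrable kernel maps functions with a limit to functions with a limit. -/
lemma tendsto_conv {r g : ℝ → ℂ} (hr : IntegrableOn r (Ioi 0)) (hg : ExpBounded 0 g) {l : ℂ}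
    (hl : Tendsto g atTop (𝓝 l)) :
    Tendsto (conv r g) atTop (𝓝 ((∫ t in Ioi (0 : ℝ), r t) * l)) := by
  obtain ⟨hc, C, hC⟩ := hg
  simp only [zero_mul, Real.exp_zero, mul_one] at hC
  have hC0 : 0 ≤ C := (norm_nonneg _).trans (hC 0 le_rfl)
  set g' : ℝ → ℂ := (Ici 0).indicator g with hg'
  have hgm : AEStronglyMeasurable g' volume :=
    (aestronglyMeasurable_indicator_iff measurableSet_Ici).2
      (hc.aestronglyMeasurable measurableSet_Ici)
  have hgC : ∀ s, ‖g' s‖ ≤ C := by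
    intro s
    by_cases h : 0 ≤ s
    · simpa [hg', h] using hC s h
    · simpa [hg', h] using hC0
  have heq : ∀ t, 0 ≤ t → ∫ s in Ioi (0 : ℝ), r s * g' (t - s) = conv r g t := by
    intro t ht
    rw [conv, intervalIntegral.integral_of_le ht,
      setIntegral_eq_of_subset_of_forall_sdiff_eq_zero measurableSet_Ioi
        (Ioc_subset_Ioi_self : Ioc 0 t ⊆ _) (f := fun s => r s * g' (t - s))]
    · refine setIntegral_congr_fun measurableSet_Ioc fun s hs => ?_
      simp [hg', hs.2]
    · intro s hs
      have : t < s := by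
        by_contra h
        exact hs.2 ⟨hs.1, not_lt.1 h⟩
      simp [hg', this]
  rw [← integral_mul_const]
  refine Tendsto.congr' (f₁ := fun t => ∫ s in Ioi (0 : ℝ), r s * g' (t - s))
    ((eventually_ge_atTop 0).mono heq) ?_
  refine tendsto_integral_filter_of_dominated_convergence (fun s => ‖r s‖ * C)
    (Eventually.of_forall fun t => hr.aestronglyMeasurable.mul
      (hgm.comp_measurePreserving (Measure.measurePreserving_sub_left volume t)).restrict)
    (Eventually.of_forall fun t => Eventually.of_forall fun s => ?_)
    (hr.norm.mul_const C) (Eventually.of_forall fun s => ?_)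
  · rw [norm_mul]
    gcongr
    exact hgC _
  · refine Tendsto.const_mul _ ?_
    have h1 : Tendsto g' atTop (𝓝 l) := hl.congr' (by
      filter_upwards [eventually_ge_atTop 0] with u hu
      simp [hg', hu])
    exact h1.comp (tendsto_atTop_add_const_right _ (-s) tendsto_id)

/-- The conclusion of the stability theorem, given an integrable resolvent. -/
theorem stability_of_resolvent {α : ℝ} (hα : α ∈ Ioo (0 : ℝ) 1) {lam : ℂ}
    (hne : ∀ p : ℝ, 0 ≤ p → (p : ℂ) ≠ lam) {r : ℝ → ℂ} (hr : IntegrableOn r (Ioi 0))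
    (hrl : ∀ p : ℝ, 0 < p → laplace r p = (((p ^ α : ℝ) : ℂ) - lam)⁻¹) {f : ℝ → ℝ}
    (hf : f ∈ CInfty ℝ) {x₀ : ℂ} {x : ℝ → ℂ} (hx : IsSolution α lam f x₀ x) :
    IsBoundedOnNonneg x ∧ (f ∈ CInftyZero ℝ → Tendsto x atTop (𝓝 0)) := by
  have hlam : lam ≠ 0 := fun h => hne 0 le_rfl (by simp [h])
  have hr0 : LaplaceConv r (0 : ℝ) := by simpa [LaplaceConv] using hr
  have hsol : ∀ t, 0 < t → x t = x₀ + conv r (fun s => (f s : ℂ) + lam * x₀) t := fun t ht =>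
    hx.eq_add_conv hα (fun p hp => hne p hp.le) hr0 hrl hf ht
  have hge : ExpBounded 0 fun s => (f s : ℂ) + lam * x₀ := by
    obtain ⟨hfc, M, hM⟩ := hf
    refine ⟨(Complex.continuous_ofReal.comp_continuousOn hfc).add continuousOn_const,
      M + ‖lam * x₀‖, fun s hs => ?_⟩
    simp only [zero_mul, Real.exp_zero, mul_one]
    refine (norm_add_le _ _).trans (add_le_add_left ?_ _)
    simpa using hM s hs
  refine ⟨?_, fun hf0 => ?_⟩
  · obtain ⟨-, C, hC⟩ := hge.conv hr0
    simp only [zero_mul, Real.exp_zero, mul_one] at hC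
    have hC0 : 0 ≤ C := (norm_nonneg _).trans (hC 0 le_rfl)
    refine ⟨‖x₀‖ + C, fun t ht => ?_⟩
    rcases ht.eq_or_lt with rfl | ht'
    · rw [hx.initial]; linarith
    · rw [hsol t ht']
      exact (norm_add_le _ _).trans (add_le_add_right (hC t ht) _)
  -- The transform of `r` is known only for `p > 0`; integrability of `r` lets `p → 0⁺`, where `p^α
  -- → 0`.
  · have hint : ∫ t in Ioi (0 : ℝ), r t = -lam⁻¹ := by
      have h1 : Tendsto (fun p : ℝ => laplace r p) (𝓝[>] 0) (𝓝 (∫ t in Ioi (0 : ℝ), r t)) := by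
        refine tendsto_integral_filter_of_dominated_convergence (fun s => ‖r s‖)
          (Eventually.of_forall fun p => AEStronglyMeasurable.mul (by fun_prop)
            hr.aestronglyMeasurable) ?_ hr.norm (Eventually.of_forall fun s => ?_)
        · filter_upwards [self_mem_nhdsWithin] with p hp
          filter_upwards [ae_restrict_mem measurableSet_Ioi] with t ht
          have hp0 : 0 < p := hp
          have ht0 : 0 < t := ht
          rw [norm_mul, norm_exp_neg_mul, Complex.ofReal_re]
          refine mul_le_of_le_one_left (norm_nonneg _) (Real.exp_le_one_iff.2 ?_)
          nlinarith
        · have : Tendsto (fun p : ℝ => Complex.exp (-(p : ℂ) * s) * r s) (𝓝 0)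
              (𝓝 (Complex.exp (-((0 : ℝ) : ℂ) * s) * r s)) :=
            Continuous.tendsto (f := fun p : ℝ => Complex.exp (-(p : ℂ) * s) * r s)
              (by fun_prop) 0
          simp only [Complex.ofReal_zero, neg_zero, zero_mul, Complex.exp_zero, one_mul] at this
          exact this.mono_left nhdsWithin_le_nhds
      have h2 : Tendsto (fun p : ℝ => (((p ^ α : ℝ) : ℂ) - lam)⁻¹) (𝓝[>] 0) (𝓝 (-lam⁻¹)) := by
        have h3 : Tendsto (fun p : ℝ => p ^ α) (𝓝[>] 0) (𝓝 0) := by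
          have := (Real.continuousAt_rpow_const 0 α (Or.inr hα.1.le)).tendsto
          rw [Real.zero_rpow hα.1.ne'] at this
          exact this.mono_left nhdsWithin_le_nhds
        have h4 := (((Complex.continuous_ofReal.tendsto 0).comp h3).sub_const lam).inv₀
          (by simpa using hlam)
        rw [Complex.ofReal_zero, zero_sub, inv_neg] at h4
        exact h4
      refine tendsto_nhds_unique (h1.congr' ?_) h2
      filter_upwards [self_mem_nhdsWithin] with p hp
      exact hrl p hp
    have hgl : Tendsto (fun s => (f s : ℂ) + lam * x₀) atTop (𝓝 (lam * x₀)) := by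
      have := (tendsto_zero_iff_norm_tendsto_zero.2 hf0.2).ofReal.add_const (lam * x₀)
      simpa using this
    have h5 := (tendsto_conv hr hge hgl).const_add x₀
    rw [hint, show x₀ + -lam⁻¹ * (lam * x₀) = 0 by field_simp; ring] at h5
    refine h5.congr' ?_
    filter_upwards [eventually_gt_atTop 0] with t ht
    exact (hsol t ht).symm

/-! ### Cauchy's formula on a strip. -/

/-- The values of `1/(z - a)` on the lines `Im z = -θ` and `Im z = θ` differ by `2i` times this
Poisson kernel. Its mass `π` supplies the factor `2πi` in Cauchy's formula. -/
lemma integrable_poisson (a : ℝ) {θ : ℝ} (hθ : 0 < θ) :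
    Integrable (fun x : ℝ => θ / ((x - a) ^ 2 + θ ^ 2)) ∧
      ∫ x : ℝ, θ / ((x - a) ^ 2 + θ ^ 2) = Real.pi := by
  have h : ∀ x : ℝ, θ / ((x - a) ^ 2 + θ ^ 2) = θ⁻¹ * (1 + ((x - a) / θ) ^ 2)⁻¹ := by
    intro x
    have : 0 < (x - a) ^ 2 + θ ^ 2 := by positivity
    field_simp
    ring
  simp only [h]
  refine ⟨((integrable_inv_one_add_sq.comp_div hθ.ne').comp_sub_right a).const_mul _, ?_⟩
  rw [integral_const_mul, integral_sub_right_eq_self (fun x : ℝ => (1 + (x / θ) ^ 2)⁻¹) a,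
    Measure.integral_comp_div (fun x : ℝ => (1 + x ^ 2)⁻¹) θ, integral_univ_inv_one_add_sq,
    abs_of_pos hθ, smul_eq_mul]
  field_simp

/-- Cauchy's integral formula on a horizontal strip. -/
theorem integral_strip_eq {n : ℂ → ℂ} {a θ : ℝ} (hθ : 0 < θ) {U : Set ℂ} (hUo : IsOpen U)
    (hU : ∀ z : ℂ, |z.im| ≤ θ → z ∈ U) (hn : DifferentiableOn ℂ n U) {R C c : ℝ} (hc : 0 < c)
    (hb : ∀ z : ℂ, |z.im| ≤ θ → R ≤ |z.re| → ‖n z / (z - a)‖ ≤ C * Real.exp (-c * |z.re|))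
    (h1 : Integrable fun u : ℝ =>
      n (u + ((-θ : ℝ) : ℂ) * Complex.I) / (u + ((-θ : ℝ) : ℂ) * Complex.I - a))
    (h2 : Integrable fun u : ℝ => n (u + (θ : ℂ) * Complex.I) / (u + (θ : ℂ) * Complex.I - a)) :
    (∫ u : ℝ, n (u + ((-θ : ℝ) : ℂ) * Complex.I) / (u + ((-θ : ℝ) : ℂ) * Complex.I - a)) -
      (∫ u : ℝ, n (u + (θ : ℂ) * Complex.I) / (u + (θ : ℂ) * Complex.I - a)) =
      2 * Real.pi * Complex.I * n a := by
  have haU : (a : ℂ) ∈ U := hU _ (by simp [hθ.le])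
  -- The divided difference removes the pole at `a`, so integrals of `D` over rectangles vanish and
  -- no residue theorem is needed.
  set D := dslope n (a : ℂ) with hD
  have hDd : DifferentiableOn ℂ D U :=
    (Complex.differentiableOn_dslope (hUo.mem_nhds haU)).2 hn
  have hDe : ∀ z : ℂ, z ≠ a → D z = n z / (z - a) - n a / (z - a) := by
    intro z hz
    rw [hD, dslope_of_ne _ hz, slope_def_field, sub_div]
  have hne : ∀ (y : ℝ), y ≠ 0 → ∀ u : ℝ, (u : ℂ) + (y : ℂ) * Complex.I - a ≠ 0 := by
    intro y hy u h
    have := congrArg Complex.im h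
    simp at this
    exact hy this
  obtain ⟨hP1, hP2⟩ := integrable_poisson a hθ
  have hP3 : Integrable fun x : ℝ => ((θ / ((x - a) ^ 2 + θ ^ 2) : ℝ) : ℂ) := hP1.ofReal
  -- the difference of the two horizontal integrands
  set Φ : ℝ → ℂ := fun u =>
    D (u + ((-θ : ℝ) : ℂ) * Complex.I) - D (u + (θ : ℂ) * Complex.I) with hΦ
  have hΦe : ∀ u, Φ u =
      (n (u + ((-θ : ℝ) : ℂ) * Complex.I) / (u + ((-θ : ℝ) : ℂ) * Complex.I - a) -
      n (u + (θ : ℂ) * Complex.I) / (u + (θ : ℂ) * Complex.I - a)) -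
      2 * Complex.I * n a * ((θ / ((u - a) ^ 2 + θ ^ 2) : ℝ) : ℂ) := by
    intro u
    have e1 := hne (-θ) (by linarith) u
    have e2 := hne θ hθ.ne' u
    simp only [hΦ]
    rw [hDe _ (sub_ne_zero.1 e1), hDe _ (sub_ne_zero.1 e2)]
    have e3 : n a / (u + ((-θ : ℝ) : ℂ) * Complex.I - a) - n a / (u + (θ : ℂ) * Complex.I - a) =
        2 * Complex.I * n a * ((θ / ((u - a) ^ 2 + θ ^ 2) : ℝ) : ℂ) := by
      have e4 : (((u - a) ^ 2 + θ ^ 2 : ℝ) : ℂ) =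
          (u + ((-θ : ℝ) : ℂ) * Complex.I - a) * (u + (θ : ℂ) * Complex.I - a) := by
        push_cast
        linear_combination ((θ : ℂ) ^ 2) * Complex.I_sq
      rw [Complex.ofReal_div, e4, div_sub_div _ _ e1 e2, mul_div_assoc']
      congr 1
      push_cast
      ring
    linear_combination -e3
  have hΦi : Integrable Φ := by
    rw [funext hΦe]
    exact (h1.sub h2).sub (hP3.const_mul _)
  -- On a single line the part `n a / (z - a)` of `D` decays only like `1/|u|`. The difference `Φ`
  -- is integrable, so its integral is a limit over truncated rectangles.
  have hlim : Tendsto (fun T : ℝ => ∫ u in (a - T)..(a + T), Φ u) atTop (𝓝 (∫ u, Φ u)) :=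
    intervalIntegral_tendsto_integral hΦi
      (tendsto_const_nhds.add_atBot tendsto_neg_atTop_atBot)
      (tendsto_const_nhds.add_atTop tendsto_id)
  have hDc : ∀ y : ℝ, |y| ≤ θ → Continuous fun u : ℝ => D (u + (y : ℂ) * Complex.I) :=
    fun y hy => hDd.continuousOn.comp_continuous (by fun_prop) fun u => hU _ (by simpa using hy)
  have hrect : ∀ T : ℝ, 0 < T → ∫ u in (a - T)..(a + T), Φ u =
      Complex.I * (∫ y in (-θ)..θ, D ((a - T : ℝ) + y * Complex.I)) -
      Complex.I * (∫ y in (-θ)..θ, D ((a + T : ℝ) + y * Complex.I)) := by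
    intro T hT
    have := Complex.integral_boundary_rect_eq_zero_of_differentiableOn D
      (⟨a - T, -θ⟩ : ℂ) (⟨a + T, θ⟩ : ℂ) (hDd.mono fun z hz => hU z (by
        have := hz.2
        simp only [mem_preimage] at this
        rw [uIcc_of_le (by linarith)] at this
        exact abs_le.2 this))
    simp only [smul_eq_mul] at this
    simp only [hΦ]
    rw [intervalIntegral.integral_sub ((hDc (-θ) (by simp [abs_of_pos hθ])).intervalIntegrable _ _)
      ((hDc θ (by simp [abs_of_pos hθ])).intervalIntegrable _ _)]
    linear_combination this
  -- Bound for `D` on the vertical sides: the two terms come from `n z / (z - a)` and `n a / (z -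
  -- a)`.
  set B : ℝ → ℝ := fun T => C * Real.exp (-c * (T - |a|)) + ‖n a‖ / T with hB
  have hvert : ∀ T, max 1 (R + |a|) ≤ T → ∀ s : ℝ, |s - a| = T →
      ‖∫ y in (-θ)..θ, D (s + y * Complex.I)‖ ≤ B T * |θ - -θ| := by
    intro T hT s hs
    have hT1 : 1 ≤ T := (le_max_left _ _).trans hT
    have hT2 : R + |a| ≤ T := (le_max_right _ _).trans hT
    have hsT : T - |a| ≤ |s| := by
      have := abs_sub s a
      linarith
    refine intervalIntegral.norm_integral_le_of_norm_le_const fun y hy => ?_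
    rw [uIoc_of_le (by linarith)] at hy
    have hre : ((s : ℂ) + y * Complex.I).re = s := by simp
    have him : ((s : ℂ) + y * Complex.I).im = y := by simp
    have hza : T ≤ ‖(s : ℂ) + y * Complex.I - a‖ := by
      have := Complex.abs_re_le_norm ((s : ℂ) + y * Complex.I - a)
      simp only [Complex.sub_re, hre, Complex.ofReal_re] at this
      rwa [hs] at this
    have hz0 : (s : ℂ) + y * Complex.I ≠ a := by
      intro h
      rw [h] at hza
      simp at hza
      linarith
    rw [hDe _ hz0]
    have hbd := hb (s + y * Complex.I) (by rw [him]; exact abs_le.2 ⟨hy.1.le, hy.2⟩)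
      (by rw [hre]; linarith)
    have hC : 0 ≤ C := by
      by_contra hC
      have := (norm_nonneg _).trans hbd
      have h0 := Real.exp_pos (-c * |((s : ℂ) + y * Complex.I).re|)
      nlinarith
    refine (norm_sub_le _ _).trans (add_le_add (hbd.trans ?_) ?_)
    · rw [hre]
      gcongr C * Real.exp ?_
      nlinarith
    · rw [norm_div]
      gcongr
  have hB0 : Tendsto (fun T => B T * |θ - -θ|) atTop (𝓝 0) := by
    have t1 : Tendsto (fun T : ℝ => C * Real.exp (-c * (T - |a|))) atTop (𝓝 (C * 0)) := by
      refine Tendsto.const_mul _ (Real.tendsto_exp_atBot.comp ?_)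
      exact (tendsto_atTop_add_const_right _ (-|a|) tendsto_id).const_mul_atTop_of_neg (by linarith)
    have t2 : Tendsto (fun T : ℝ => ‖n a‖ / T) atTop (𝓝 0) :=
      tendsto_const_nhds.div_atTop tendsto_id
    simpa [hB] using (t1.add t2).mul_const |θ - -θ|
  have hzero : Tendsto (fun T : ℝ => ∫ u in (a - T)..(a + T), Φ u) atTop (𝓝 0) := by
    refine squeeze_zero_norm' (a := fun T => B T * |θ - -θ| + B T * |θ - -θ|) ?_
      (by simpa using hB0.add hB0)
    filter_upwards [eventually_ge_atTop (max 1 (R + |a|))] with T hT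
    have hT1 : 0 < T := by linarith [(le_max_left _ _).trans hT]
    rw [hrect T hT1]
    refine (norm_sub_le _ _).trans (add_le_add ?_ ?_)
    · rw [norm_mul, Complex.norm_I, one_mul]
      exact hvert T hT _ (by rw [show a - T - a = -T by ring, abs_neg, abs_of_pos hT1])
    · rw [norm_mul, Complex.norm_I, one_mul]
      exact hvert T hT _ (by rw [show a + T - a = T by ring, abs_of_pos hT1])
  have hfin := tendsto_nhds_unique hlim hzero
  have hsub := integral_sub (h1.sub h2) (hP3.const_mul (2 * Complex.I * n a))
  simp only [Pi.sub_apply] at hsub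
  rw [integral_sub h1 h2, integral_const_mul, integral_complex_ofReal, hP2] at hsub
  rw [funext hΦe] at hfin
  have hfin' := hsub.symm.trans hfin
  linear_combination hfin'

/-! ### Estimates for the resolvent symbol. -/

/-- A lower bound for `exp v - lam` on a strip that misses the logarithms of `lam`. -/
lemma exists_le_norm_exp_sub {lam : ℂ} (hlam : lam ≠ 0) {β : ℝ} (hβ : β < |lam.arg|) :
    ∃ c, 0 < c ∧ ∀ v : ℂ, |v.im| ≤ β → c * (Real.exp v.re + 1) ≤ ‖Complex.exp v - lam‖ := by
  have hβπ : β < Real.pi := hβ.trans_le (Complex.abs_arg_le_pi _)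
  -- Here `v` is the principal logarithm of `e^v`, so `e^v = λ` would force `Im v = arg λ`.
  have hnz : ∀ v : ℂ, |v.im| ≤ β → Complex.exp v - lam ≠ 0 := by
    intro v hv h
    have h1 := abs_le.1 (hv.trans hβπ.le)
    have h2 := Complex.log_exp (x := v) (by
      have := (abs_lt.1 (hv.trans_lt hβπ)).1; linarith) h1.2
    rw [sub_eq_zero.1 h] at h2
    have h3 := congrArg Complex.im h2
    rw [Complex.log_im] at h3
    rw [h3] at hβ
    linarith
  have hl : 0 < ‖lam‖ := norm_pos_iff.2 hlam
  -- Left of `lo` and right of `hi`, `|e^v|` is far enough from `|λ|` for the reverse triangle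
  -- inequality; the rectangle between them is compact.
  set lo := min (Real.log (‖lam‖ / 2)) 0
  set hi := Real.log (2 * ‖lam‖ + 1)
  have hK : IsCompact (Icc lo hi ×ℂ Icc (-β) β) := isCompact_Icc.reProdIm isCompact_Icc
  obtain ⟨K, hKb⟩ := hK.exists_bound_of_continuousOn
    (f := fun v : ℂ => (Real.exp v.re + 1) / ‖Complex.exp v - lam‖)
    (ContinuousOn.div (by fun_prop) (by fun_prop) fun v hv =>
      norm_ne_zero_iff.2 (hnz v (abs_le.2 hv.2)))
  refine ⟨min (min (1 / 2) (‖lam‖ / 4)) (1 / (|K| + 1)), by positivity, fun v hv => ?_⟩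
  have hpos : 0 < Real.exp v.re + 1 := by positivity
  rcases le_total hi v.re with h | h
  · have h1 : 2 * ‖lam‖ + 1 ≤ Real.exp v.re := by
      rwa [← Real.log_le_iff_le_exp (by positivity)]
    have h2 := norm_sub_norm_le (Complex.exp v) lam
    rw [Complex.norm_exp] at h2
    calc _ ≤ 1 / 2 * (Real.exp v.re + 1) := by
          gcongr; exact (min_le_left _ _).trans (min_le_left _ _)
      _ ≤ _ := by linarith
  rcases le_total v.re lo with h' | h'
  · have h1 : Real.exp v.re ≤ ‖lam‖ / 2 := by
      rw [← Real.le_log_iff_exp_le (by positivity)]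
      exact h'.trans (min_le_left _ _)
    have h3 : Real.exp v.re ≤ 1 := Real.exp_le_one_iff.2 (h'.trans (min_le_right _ _))
    have h2 := norm_sub_norm_le lam (Complex.exp v)
    rw [Complex.norm_exp, norm_sub_rev] at h2
    calc _ ≤ ‖lam‖ / 4 * (Real.exp v.re + 1) := by
          gcongr; exact (min_le_left _ _).trans (min_le_right _ _)
      _ ≤ _ := by nlinarith
  · have h1 := hKb v ⟨⟨h', h⟩, abs_le.1 hv⟩
    have h2 : 0 < ‖Complex.exp v - lam‖ := norm_pos_iff.2 (hnz v hv)
    rw [Real.norm_of_nonneg (by positivity), div_le_iff₀ h2] at h1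
    calc _ ≤ 1 / (|K| + 1) * (Real.exp v.re + 1) := by
          gcongr; exact min_le_right _ _
      _ ≤ _ := by
        rw [one_div_mul_eq_div, div_le_iff₀ (by positivity)]
        nlinarith [le_abs_self K]

lemma integrable_exp_neg_mul_abs {c : ℝ} (hc : 0 < c) :
    Integrable fun u : ℝ => Real.exp (-c * |u|) := by
  rw [← integrableOn_univ, ← Iic_union_Ioi (a := (0 : ℝ)), integrableOn_union]
  constructor
  · refine (integrableOn_exp_mul_Iic hc 0).congr_fun (fun u hu => ?_) measurableSet_Iic
    simp only [abs_of_nonpos (mem_Iic.1 hu)]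
    ring_nf
  · refine (integrableOn_exp_mul_Ioi (neg_lt_zero.2 hc) 0).congr_fun (fun u hu => ?_)
      measurableSet_Ioi
    simp only [abs_of_pos (mem_Ioi.1 hu)]

/-- The resolvent symbol `(s ^ α - lam)⁻¹` in the logarithmic variable `z = log s`, corrected by a
multiple of `(s + 1)⁻¹` so as to vanish at `s = 0`. -/
def symbol (α : ℝ) (lam z : ℂ) : ℂ :=
  (Complex.exp (α * z) - lam)⁻¹ + (lam * (Complex.exp z + 1))⁻¹

lemma exp_sub_ne_zero {lam : ℂ} (hlam : lam ≠ 0) {β : ℝ} (hβ : β < |lam.arg|) {v : ℂ}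
    (hv : |v.im| ≤ β) : Complex.exp v - lam ≠ 0 := by
  obtain ⟨c, hc, h⟩ := exists_le_norm_exp_sub hlam hβ
  have h1 := h v hv
  intro h0
  rw [h0, norm_zero] at h1
  have : 0 < c * (Real.exp v.re + 1) := by positivity
  linarith

lemma exp_add_one_ne_zero {v : ℂ} (hv : |v.im| < Real.pi) : Complex.exp v + 1 ≠ 0 := by
  have := exp_sub_ne_zero (lam := -1) (by simp) (β := |v.im|)
    (by rwa [Complex.arg_neg_one, abs_of_pos Real.pi_pos]) le_rfl
  simpa using this

lemma abs_im_ofReal_mul_le {α θ : ℝ} (hα : 0 < α) {z : ℂ} (hz : |z.im| ≤ θ) :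
    |((α : ℂ) * z).im| ≤ α * θ := by
  rw [Complex.im_ofReal_mul, abs_mul, abs_of_pos hα]
  gcongr

/-- For `Re z → ∞` both terms are `O(e^{-α Re z})`, because `α < 1`. For `Re z → -∞` their limits
`-λ⁻¹` and `λ⁻¹` cancel, and over a common denominator the numerator is `λe^z + e^{αz}`. -/
lemma exists_norm_symbol_le {α : ℝ} (hα : α ∈ Ioo (0 : ℝ) 1) {lam : ℂ} (hlam : lam ≠ 0) {θ : ℝ}
    (hθ : θ < Real.pi) (hαθ : α * θ < |lam.arg|) :
    ∃ C, ∀ z : ℂ, |z.im| ≤ θ → ‖symbol α lam z‖ ≤ C * Real.exp (-α * |z.re|) := by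
  obtain ⟨c, hc, hcb⟩ := exists_le_norm_exp_sub hlam hαθ
  obtain ⟨d, hd, hdb⟩ := exists_le_norm_exp_sub (lam := -1) (by simp) (β := θ)
    (by rwa [Complex.arg_neg_one, abs_of_pos Real.pi_pos])
  simp only [sub_neg_eq_add] at hdb
  have hl : 0 < ‖lam‖ := norm_pos_iff.2 hlam
  refine ⟨(c⁻¹ + (‖lam‖ * d)⁻¹) + (‖lam‖ + 1) / (‖lam‖ * c * d), fun z hz => ?_⟩
  have h1 := hcb (α * z) (abs_im_ofReal_mul_le hα.1 hz)
  have h2 := hdb z hz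
  rw [Complex.re_ofReal_mul] at h1
  have e1 : 0 < Real.exp (α * z.re) := Real.exp_pos _
  have e2 : 0 < Real.exp z.re := Real.exp_pos _
  have hcoef : 0 ≤ (‖lam‖ + 1) / (‖lam‖ * c * d) := by positivity
  have hcoef' : 0 ≤ c⁻¹ + (‖lam‖ * d)⁻¹ := by positivity
  rcases le_total 0 z.re with h | h
  · rw [abs_of_nonneg h]
    have hle : Real.exp (α * z.re) ≤ Real.exp z.re := by
      gcongr; nlinarith [hα.2]
    have b1 : c * Real.exp (α * z.re) ≤ ‖Complex.exp (α * z) - lam‖ := by nlinarith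
    have b2 : d * Real.exp (α * z.re) ≤ ‖Complex.exp z + 1‖ := by nlinarith
    calc ‖symbol α lam z‖ ≤ ‖Complex.exp (α * z) - lam‖⁻¹ + (‖lam‖ * ‖Complex.exp z + 1‖)⁻¹ := by
          rw [symbol, ← norm_mul, ← norm_inv, ← norm_inv]
          exact norm_add_le _ _
      _ ≤ (c * Real.exp (α * z.re))⁻¹ + (‖lam‖ * (d * Real.exp (α * z.re)))⁻¹ := by gcongr
      _ = (c⁻¹ + (‖lam‖ * d)⁻¹) * Real.exp (-α * z.re) := by
          rw [neg_mul, Real.exp_neg]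
          field_simp
      _ ≤ _ := mul_le_mul_of_nonneg_right (by linarith) (Real.exp_pos _).le
  · rw [abs_of_nonpos h]
    have hle : Real.exp z.re ≤ Real.exp (α * z.re) := by
      gcongr; nlinarith [hα.2]
    have b1 : c ≤ ‖Complex.exp (α * z) - lam‖ := by nlinarith
    have b2 : d ≤ ‖Complex.exp z + 1‖ := by nlinarith
    have n1 : Complex.exp (α * z) - lam ≠ 0 := norm_pos_iff.1 (hc.trans_le b1)
    have n2 : Complex.exp z + 1 ≠ 0 := norm_pos_iff.1 (hd.trans_le b2)
    have hs : symbol α lam z = (lam * Complex.exp z + Complex.exp (α * z)) /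
        (lam * (Complex.exp (α * z) - lam) * (Complex.exp z + 1)) := by
      rw [symbol]
      field_simp
      ring
    have hnum : ‖lam * Complex.exp z + Complex.exp (α * z)‖ ≤
        (‖lam‖ + 1) * Real.exp (α * z.re) := by
      refine (norm_add_le _ _).trans ?_
      rw [norm_mul, Complex.norm_exp, Complex.norm_exp, Complex.re_ofReal_mul, add_mul, one_mul]
      gcongr
    calc ‖symbol α lam z‖ ≤ ((‖lam‖ + 1) * Real.exp (α * z.re)) / (‖lam‖ * c * d) := by
          rw [hs, norm_div, norm_mul, norm_mul]
          gcongr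
      _ = (‖lam‖ + 1) / (‖lam‖ * c * d) * Real.exp (-α * -z.re) := by
          rw [neg_mul_neg]; ring
      _ ≤ _ := by gcongr; linarith

lemma differentiableAt_symbol {α : ℝ} {lam z : ℂ} (hlam : lam ≠ 0)
    (h1 : Complex.exp (α * z) - lam ≠ 0) (h2 : Complex.exp z + 1 ≠ 0) :
    DifferentiableAt ℂ (symbol α lam) z := by
  unfold symbol
  refine DifferentiableAt.add (DifferentiableAt.inv (by fun_prop) h1)
    (DifferentiableAt.inv (by fun_prop) (mul_ne_zero hlam h2))

/-! ### Ray integrals and their Laplace transforms. -/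

/-- The contribution of the ray `arg s = y` to the inverse Laplace integral of the symbol. -/
def rayIntegral (α : ℝ) (lam : ℂ) (y t : ℝ) : ℂ :=
  ∫ u : ℝ, symbol α lam (u + y * Complex.I) * Complex.exp (u + y * Complex.I) *
    Complex.exp (Complex.exp (u + y * Complex.I) * t)

section ray

variable {α : ℝ} {lam : ℂ} {θ y : ℝ}

lemma re_exp_line (u y : ℝ) :
    (Complex.exp (u + y * Complex.I)).re = Real.exp u * Real.cos y := by
  rw [Complex.exp_re]; simp

lemma continuous_symbol_line (hα : 0 < α) (hlam : lam ≠ 0) (hθ : θ < Real.pi)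
    (hαθ : α * θ < |lam.arg|) (hy : |y| ≤ θ) :
    Continuous fun u : ℝ => symbol α lam (u + y * Complex.I) := by
  refine continuous_iff_continuousAt.2 fun u => ?_
  have him : |((u : ℂ) + y * Complex.I).im| ≤ θ := by simpa using hy
  exact ContinuousAt.comp (f := fun u : ℝ => (u : ℂ) + y * Complex.I)
    (differentiableAt_symbol hlam (exp_sub_ne_zero hlam hαθ (abs_im_ofReal_mul_le hα him))
      (exp_add_one_ne_zero (him.trans_lt hθ))).continuousAt (by fun_prop)

/-- Integrating the norm in `t` first gives `|symbol| e^u / (p - e^u cos y) ≤ |symbol| / (-cos y)`,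
which is integrable in `u`. The uncorrected symbol tends to `-λ⁻¹` as `u → -∞` and would fail here.
The case `p = 0` gives integrability of the ray integral; every `p ≥ 0` gives Fubini for its
transform. -/
lemma integrable_ray (hα : α ∈ Ioo (0 : ℝ) 1) (hlam : lam ≠ 0) (hθ : θ < Real.pi)
    (hαθ : α * θ < |lam.arg|) (hy : |y| ≤ θ) (hcos : Real.cos y < 0) {p : ℝ} (hp : 0 ≤ p) :
    Integrable (fun q : ℝ × ℝ => symbol α lam (q.2 + y * Complex.I) *
      Complex.exp (q.2 + y * Complex.I) *
        Complex.exp ((Complex.exp (q.2 + y * Complex.I) - p) * q.1))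
      ((volume.restrict (Ioi 0)).prod volume) := by
  have hcs := continuous_symbol_line hα.1 hlam hθ hαθ hy
  have hre : ∀ u : ℝ, (Complex.exp (u + y * Complex.I) - p).re = Real.exp u * Real.cos y - p :=
    fun u => by rw [Complex.sub_re, re_exp_line, Complex.ofReal_re]
  have hneg : ∀ u : ℝ, Real.exp u * Real.cos y - p < 0 := fun u => by
    have := mul_neg_of_pos_of_neg (Real.exp_pos u) hcos
    linarith
  obtain ⟨C, hC⟩ := exists_norm_symbol_le hα hlam hθ hαθ
  refine (integrable_prod_iff' ?_).2 ⟨Eventually.of_forall fun u => ?_, ?_⟩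
  · refine Continuous.aestronglyMeasurable ?_
    exact ((hcs.comp continuous_snd).mul (by fun_prop)).mul (by fun_prop)
  · exact (integrableOn_exp_mul_complex_Ioi (by rw [hre]; exact hneg u) 0).const_mul
      (symbol α lam (u + y * Complex.I) * Complex.exp (u + y * Complex.I))
  · have hval : ∀ u : ℝ, ∫ t in Ioi (0 : ℝ), ‖symbol α lam (u + y * Complex.I) *
        Complex.exp (u + y * Complex.I) *
          Complex.exp ((Complex.exp (u + y * Complex.I) - p) * t)‖ =
        ‖symbol α lam (u + y * Complex.I)‖ * (Real.exp u / (p - Real.exp u * Real.cos y)) := by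
      intro u
      have hn : ∀ t : ℝ, ‖symbol α lam (u + y * Complex.I) *
        Complex.exp (u + y * Complex.I) *
          Complex.exp ((Complex.exp (u + y * Complex.I) - p) * t)‖ =
          ‖symbol α lam (u + y * Complex.I)‖ * Real.exp u *
            Real.exp ((Real.exp u * Real.cos y - p) * t) := by
        intro t
        rw [norm_mul, norm_mul, Complex.norm_exp, Complex.norm_exp, Complex.re_mul_ofReal, hre]
        simp
      simp only [hn]
      rw [integral_const_mul, integral_exp_mul_Ioi (hneg u), mul_zero, Real.exp_zero,
        neg_div, ← div_neg, neg_sub]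
      ring
    simp only [hval]
    have hden : ∀ u : ℝ, p - Real.exp u * Real.cos y ≠ 0 := fun u => by linarith [hneg u]
    refine Integrable.mono' (((integrable_exp_neg_mul_abs hα.1).const_mul C).mul_const
      (-Real.cos y)⁻¹) ?_ (Eventually.of_forall fun u => ?_)
    · refine Continuous.aestronglyMeasurable (hcs.norm.mul ?_)
      exact Continuous.div (by fun_prop) (by fun_prop) hden
    · have hd : 0 < p - Real.exp u * Real.cos y := by linarith [hneg u]
      rw [Real.norm_of_nonneg (by positivity)]
      have h1 := hC (u + y * Complex.I) (by simpa using hy)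
      simp only [Complex.add_re, Complex.ofReal_re, Complex.re_ofReal_mul, Complex.I_re, mul_zero,
        add_zero] at h1
      refine mul_le_mul h1 ?_ (by positivity) ((norm_nonneg _).trans h1)
      rw [div_le_iff₀ hd, inv_mul_eq_div, le_div_iff₀ (by linarith)]
      linarith

lemma integrableOn_rayIntegral (hα : α ∈ Ioo (0 : ℝ) 1) (hlam : lam ≠ 0) (hθ : θ < Real.pi)
    (hαθ : α * θ < |lam.arg|) (hy : |y| ≤ θ) (hcos : Real.cos y < 0) :
    IntegrableOn (rayIntegral α lam y) (Ioi 0) := by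
  have h := (integrable_ray hα hlam hθ hαθ hy hcos le_rfl).integral_prod_left
  simp only [Complex.ofReal_zero, sub_zero] at h
  exact h

lemma integrable_line (hα : α ∈ Ioo (0 : ℝ) 1) (hlam : lam ≠ 0) (hθ : θ < Real.pi)
    (hαθ : α * θ < |lam.arg|) (hy : |y| ≤ θ) (hcos : Real.cos y < 0) {p : ℝ} (hp : 0 ≤ p) :
    Integrable fun u : ℝ => symbol α lam (u + y * Complex.I) * Complex.exp (u + y * Complex.I) /
        (p - Complex.exp (u + y * Complex.I)) := by
  have h := (integrable_ray hα hlam hθ hαθ hy hcos hp).integral_prod_right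
  refine h.congr (Eventually.of_forall fun u => ?_)
  have hneg : (Complex.exp (u + y * Complex.I) - p).re < 0 := by
    rw [Complex.sub_re, re_exp_line, Complex.ofReal_re]
    linarith [mul_neg_of_pos_of_neg (Real.exp_pos u) hcos]
  simp only
  rw [integral_const_mul, integral_exp_mul_complex_Ioi hneg, Complex.ofReal_zero, mul_zero,
    Complex.exp_zero, neg_div, ← div_neg, neg_sub]
  ring

lemma laplace_rayIntegral (hα : α ∈ Ioo (0 : ℝ) 1) (hlam : lam ≠ 0) (hθ : θ < Real.pi)
    (hαθ : α * θ < |lam.arg|) (hy : |y| ≤ θ) (hcos : Real.cos y < 0) {p : ℝ} (hp : 0 ≤ p) :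
    laplace (rayIntegral α lam y) p =
      ∫ u : ℝ, symbol α lam (u + y * Complex.I) * Complex.exp (u + y * Complex.I) /
        (p - Complex.exp (u + y * Complex.I)) := by
  have hsw := integral_integral_swap (f := fun t u : ℝ => symbol α lam (u + y * Complex.I) *
      Complex.exp (u + y * Complex.I) *
        Complex.exp ((Complex.exp (u + y * Complex.I) - p) * t))
    (integrable_ray hα hlam hθ hαθ hy hcos hp)
  unfold laplace rayIntegral
  have h1 : ∀ t : ℝ, Complex.exp (-(p : ℂ) * t) * ∫ u : ℝ, symbol α lam (u + y * Complex.I) *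
      Complex.exp (u + y * Complex.I) * Complex.exp (Complex.exp (u + y * Complex.I) * t) =
      ∫ u : ℝ, symbol α lam (u + y * Complex.I) * Complex.exp (u + y * Complex.I) *
        Complex.exp ((Complex.exp (u + y * Complex.I) - p) * t) := by
    intro t
    rw [← integral_const_mul]
    congr 1
    ext u
    have h2 : Complex.exp ((Complex.exp (u + y * Complex.I) - p) * t) =
        Complex.exp (-(p : ℂ) * t) * Complex.exp (Complex.exp (u + y * Complex.I) * t) := by
      rw [← Complex.exp_add]
      congr 1
      ring
    rw [h2]
    ring
  simp only [h1]
  rw [hsw]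
  congr 1
  ext u
  have hneg : (Complex.exp (u + y * Complex.I) - p).re < 0 := by
    rw [Complex.sub_re, re_exp_line, Complex.ofReal_re]
    linarith [mul_neg_of_pos_of_neg (Real.exp_pos u) hcos]
  rw [integral_const_mul, integral_exp_mul_complex_Ioi hneg, Complex.ofReal_zero, mul_zero,
    Complex.exp_zero, neg_div, ← div_neg, neg_sub]
  ring

end ray

/-! ### Construction of the resolvent and conclusion. -/

/-- Cauchy's formula for the symbol, on the boundary of a strip. -/
theorem integral_line_sub_integral_line {α : ℝ} {lam : ℂ} {θ : ℝ} (hα : α ∈ Ioo (0 : ℝ) 1)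
    (hlam : lam ≠ 0) (hθ0 : 0 < θ) (hθ : θ < Real.pi) (hαθ : α * θ < |lam.arg|)
    (hcos : Real.cos θ < 0) {p : ℝ} (hp : 0 < p) :
    (∫ u : ℝ, symbol α lam (u + θ * Complex.I) * Complex.exp (u + θ * Complex.I) /
        (p - Complex.exp (u + θ * Complex.I))) -
      (∫ u : ℝ, symbol α lam (u + ((-θ : ℝ) : ℂ) * Complex.I) *
        Complex.exp (u + ((-θ : ℝ) : ℂ) * Complex.I) /
        (p - Complex.exp (u + ((-θ : ℝ) : ℂ) * Complex.I))) =
      2 * Real.pi * Complex.I * symbol α lam (Real.log p) := by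
  set a := Real.log p with ha
  have hexpa : Complex.exp (a : ℂ) = p := by
    rw [← Complex.ofReal_exp, ha, Real.exp_log hp]
  -- `E` is `(e^z - p)/(z - a)` made entire. It has no zero on the strip, since `exp` is injective
  -- on `|Im z| < π`. Dividing by it puts the integrand, up to sign, in the form `n z / (z - a)`.
  set E : ℂ → ℂ := dslope Complex.exp (a : ℂ) with hE
  have hEd : Differentiable ℂ E := by
    rw [← differentiableOn_univ]
    exact (Complex.differentiableOn_dslope univ_mem).2 Complex.differentiable_exp.differentiableOn
  have hEa : E a = p := by rw [hE, dslope_same, Complex.deriv_exp, hexpa]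
  have hEz : ∀ z : ℂ, z ≠ a → E z = (Complex.exp z - p) / (z - a) := fun z hz => by
    rw [hE, dslope_of_ne _ hz, slope_def_field, hexpa]
  have hpne : (p : ℂ) ≠ 0 := by exact_mod_cast hp.ne'
  have hinj : ∀ z : ℂ, |z.im| ≤ θ → z ≠ a → Complex.exp z - p ≠ 0 := by
    intro z hz hza h0
    have h1 := abs_lt.1 (hz.trans_lt hθ)
    have h2 := Complex.log_exp h1.1 h1.2.le
    rw [sub_eq_zero.1 h0, ← Complex.ofReal_log hp.le] at h2
    exact hza h2.symm
  have hE0 : ∀ z : ℂ, |z.im| ≤ θ → E z ≠ 0 := by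
    intro z hz
    by_cases hza : z = a
    · rw [hza, hEa]; exact hpne
    · rw [hEz z hza]
      exact div_ne_zero (hinj z hz hza) (sub_ne_zero.2 hza)
  set U : Set ℂ := {z | Complex.exp (α * z) - lam ≠ 0} ∩ ({z | Complex.exp z + 1 ≠ 0} ∩
    {z | E z ≠ 0}) with hU
  have hUo : IsOpen U := by
    refine (isOpen_ne_fun (by fun_prop) continuous_const).inter
      ((isOpen_ne_fun (by fun_prop) continuous_const).inter
        (isOpen_ne_fun hEd.continuous continuous_const))
  have hUs : ∀ z : ℂ, |z.im| ≤ θ → z ∈ U := fun z hz =>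
    ⟨exp_sub_ne_zero hlam hαθ (abs_im_ofReal_mul_le hα.1 hz),
      exp_add_one_ne_zero (hz.trans_lt hθ), hE0 z hz⟩
  set n : ℂ → ℂ := fun z => symbol α lam z * Complex.exp z / E z with hn
  have hnd : DifferentiableOn ℂ n U := fun z hz =>
    (((differentiableAt_symbol hlam hz.1 hz.2.1).mul Complex.differentiableAt_exp).div
      (hEd z) hz.2.2).differentiableWithinAt
  have hna : n a = symbol α lam a := by
    simp only [hn]
    rw [hEa, hexpa, mul_div_assoc, div_self hpne, mul_one]
  have hnz : ∀ z : ℂ, |z.im| ≤ θ → z ≠ a → n z / (z - a) =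
      -(symbol α lam z * Complex.exp z / (p - Complex.exp z)) := by
    intro z hz hza
    have h1 := hinj z hz hza
    have h2 : (p : ℂ) - Complex.exp z ≠ 0 := by rwa [← neg_sub, neg_ne_zero]
    have h3 := sub_ne_zero.2 hza
    simp only [hn]
    rw [hEz z hza, ← neg_sub (Complex.exp z), div_neg, neg_neg]
    field_simp
  obtain ⟨C, hC⟩ := exists_norm_symbol_le hα hlam hθ hαθ
  -- Beyond `R` either `|e^z| ≥ 2p` or `|e^z| ≤ p/2`, so `|e^z / (p - e^z)| ≤ 2` and the decay of
  -- the symbol survives.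
  set R := max (Real.log (2 * p)) (-Real.log (p / 2)) with hR
  have haR : |a| < R := by
    rw [hR, abs_lt, ha, neg_lt, lt_max_iff, lt_max_iff]
    constructor
    · right
      exact neg_lt_neg (Real.log_lt_log (by positivity) (by linarith))
    · left
      exact Real.log_lt_log hp (by linarith)
  have hfrac : ∀ z : ℂ, R ≤ |z.re| → ‖Complex.exp z‖ ≤ 2 * ‖p - Complex.exp z‖ := by
    intro z hz
    rw [Complex.norm_exp]
    rcases le_total 0 z.re with h | h
    · rw [abs_of_nonneg h] at hz
      have h1 : 2 * p ≤ Real.exp z.re := by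
        rw [← Real.log_le_iff_le_exp (by positivity)]
        exact (le_max_left _ _).trans hz
      have h2 := norm_sub_norm_le (Complex.exp z) p
      rw [Complex.norm_exp, Complex.norm_of_nonneg hp.le, norm_sub_rev] at h2
      linarith
    · rw [abs_of_nonpos h] at hz
      have h1 : Real.exp z.re ≤ p / 2 := by
        rw [← Real.le_log_iff_exp_le (by positivity)]
        linarith [(le_max_right _ _).trans hz]
      have h2 := norm_sub_norm_le (p : ℂ) (Complex.exp z)
      rw [Complex.norm_exp, Complex.norm_of_nonneg hp.le] at h2
      linarith
  have hb : ∀ z : ℂ, |z.im| ≤ θ → R ≤ |z.re| →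
      ‖n z / (z - a)‖ ≤ C * 2 * Real.exp (-α * |z.re|) := by
    intro z hz hzR
    have hza : z ≠ a := by
      rintro rfl
      rw [Complex.ofReal_re] at hzR
      linarith
    have h2 : 0 < ‖(p : ℂ) - Complex.exp z‖ := by
      rw [norm_pos_iff, ← neg_sub, neg_ne_zero]
      exact hinj z hz hza
    rw [hnz z hz hza, norm_neg, norm_div, norm_mul, mul_div_assoc]
    have h3 : ‖Complex.exp z‖ / ‖(p : ℂ) - Complex.exp z‖ ≤ 2 := by
      rw [div_le_iff₀ h2]; exact hfrac z hzR
    calc _ ≤ C * Real.exp (-α * |z.re|) * 2 :=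
          mul_le_mul (hC z hz) h3 (by positivity) ((norm_nonneg _).trans (hC z hz))
      _ = _ := by ring
  have hline : ∀ y : ℝ, |y| = θ → ∀ u : ℝ, n (u + (y : ℂ) * Complex.I) /
      (u + (y : ℂ) * Complex.I - a) = -(symbol α lam (u + y * Complex.I) *
        Complex.exp (u + y * Complex.I) / (p - Complex.exp (u + y * Complex.I))) := by
    intro y hy u
    refine hnz _ (by simp [hy]) fun h => ?_
    have := congrArg Complex.im h
    simp only [Complex.add_im, Complex.ofReal_im, Complex.im_ofReal_mul, Complex.I_im, mul_one,
      zero_add] at this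
    rw [this, abs_zero] at hy
    linarith
  have hθa : |θ| = θ := abs_of_pos hθ0
  have hθn : |-θ| = θ := by rw [abs_neg, hθa]
  have i1 := integrable_line hα hlam hθ hαθ hθn.le (by rwa [Real.cos_neg]) hp.le
  have i2 := integrable_line hα hlam hθ hαθ hθa.le hcos hp.le
  have key := integral_strip_eq (n := n) (a := a) hθ0 hUo hUs hnd hα.1 hb
    (by simp only [hline _ hθn]; exact i1.neg) (by simp only [hline _ hθa]; exact i2.neg)
  simp only [hline _ hθn, hline _ hθa, integral_neg, hna] at key
  linear_combination key

/-- For `lam` in the stable sector there is an integrable function with Laplace transform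
`(p ^ α - lam)⁻¹`. -/
theorem exists_resolvent {α : ℝ} (hα : α ∈ Ioo (0 : ℝ) 1) {lam : ℂ} (hlam : lam ∈ stableSector α) :
    ∃ r : ℝ → ℂ, IntegrableOn r (Ioi 0) ∧
      ∀ p : ℝ, 0 < p → laplace r p = (((p ^ α : ℝ) : ℂ) - lam)⁻¹ := by
  obtain ⟨hl0, harg⟩ := hlam
  -- `θ > π/2` gives decay on the rays, `αθ < |arg λ|` avoids the zeros of `s^α - λ`, and `θ < π`
  -- keeps out the pole `s = -1`. The sector condition is exactly what makes these compatible.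
  obtain ⟨θ, hθ1, hθ2⟩ : ∃ θ, Real.pi / 2 < θ ∧ θ < min Real.pi (|lam.arg| / α) := by
    refine exists_between (lt_min (by linarith [Real.pi_pos]) ?_)
    rw [lt_div_iff₀ hα.1]
    linarith
  have hθ : θ < Real.pi := hθ2.trans_le (min_le_left _ _)
  have hαθ : α * θ < |lam.arg| := by
    have := hθ2.trans_le (min_le_right _ _)
    rw [lt_div_iff₀ hα.1] at this
    linarith
  have hθ0 : 0 < θ := by linarith [Real.pi_pos]
  have hcos : Real.cos θ < 0 := Real.cos_neg_of_pi_div_two_lt_of_lt hθ1 (by linarith)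
  have hcos' : Real.cos (-θ) < 0 := by rwa [Real.cos_neg]
  have hθa : |θ| ≤ θ := (abs_of_pos hθ0).le
  have hθn : |-θ| ≤ θ := by rwa [abs_neg]
  have i1 := integrableOn_rayIntegral hα hl0 hθ hαθ hθa hcos
  have i2 := integrableOn_rayIntegral hα hl0 hθ hαθ hθn hcos'
  have i3 : IntegrableOn (fun t : ℝ => Complex.exp (-1 * t)) (Ioi 0) :=
    integrableOn_exp_mul_complex_Ioi (by simp) 0
  have conv0 : ∀ {u : ℝ → ℂ}, IntegrableOn u (Ioi 0) → ∀ {p : ℝ}, 0 < p → LaplaceConv u p :=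
    fun {u} hu {p} hp => LaplaceConv.mono (p := ((0 : ℝ) : ℂ)) (by simpa [LaplaceConv] using hu)
      (by simpa using hp.le)
  set c : ℂ := (2 * Real.pi * Complex.I)⁻¹ with hc
  have hpi : (2 * Real.pi * Complex.I : ℂ) ≠ 0 := Complex.two_pi_I_ne_zero
  have i4 : IntegrableOn (fun t => c * rayIntegral α lam θ t + -c * rayIntegral α lam (-θ) t)
      (Ioi 0) := (i1.const_mul _).add (i2.const_mul _)
  -- The upper ray minus the lower, over `2πi`, has the corrected symbol as its transform;
  -- `-λ⁻¹e^{-t}` takes the correction back.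
  refine ⟨fun t => -lam⁻¹ * Complex.exp (-1 * t) +
    (c * rayIntegral α lam θ t + -c * rayIntegral α lam (-θ) t), ?_, fun p hp => ?_⟩
  · exact (i3.const_mul _).add i4
  · rw [laplace_add (conv0 (i3.const_mul _) hp) (conv0 i4 hp),
      laplace_add (conv0 (i1.const_mul _) hp) (conv0 (i2.const_mul _) hp), laplace_const_mul,
      laplace_const_mul, laplace_const_mul, laplace_rayIntegral hα hl0 hθ hαθ hθa hcos hp.le,
      laplace_rayIntegral hα hl0 hθ hαθ hθn hcos' hp.le]
    have key := integral_line_sub_integral_line hα hl0 hθ0 hθ hαθ hcos hp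
    have hexp : laplace (fun t : ℝ => Complex.exp (-1 * t)) p = ((p : ℂ) + 1)⁻¹ := by
      unfold laplace
      simp only [← Complex.exp_add, ← add_mul]
      rw [integral_exp_mul_complex_Ioi (by simp; linarith), Complex.ofReal_zero, mul_zero,
        Complex.exp_zero, neg_div, ← div_neg, one_div]
      congr 1
      ring
    have hsym : symbol α lam (Real.log p) = (((p ^ α : ℝ) : ℂ) - lam)⁻¹ + (lam * (p + 1))⁻¹ := by
      rw [symbol, ← Complex.ofReal_mul, ← Complex.ofReal_exp, ← Complex.ofReal_exp,
        Real.exp_log hp, Real.rpow_def_of_pos hp, mul_comm α]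
    have hcm : c * (2 * Real.pi * Complex.I) = 1 := inv_mul_cancel₀ hpi
    rw [hexp]
    rw [hsym, mul_inv] at key
    linear_combination c * key +
      ((((p ^ α : ℝ) : ℂ) - lam)⁻¹ + lam⁻¹ * ((p : ℂ) + 1)⁻¹) * hcm

end

end FractionalPerron

theorem proposition1 (α : ℝ) (hα : α ∈ Set.Ioo (0 : ℝ) 1) (lam : ℂ)
    (hlam : lam ∈ FractionalPerron.stableSector α) (f : ℝ → ℝ)
    (hf : f ∈ FractionalPerron.CInfty ℝ) :
    (∀ (x₀ : ℂ) (x : ℝ → ℂ), FractionalPerron.IsSolution α lam f x₀ x →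
      FractionalPerron.IsBoundedOnNonneg x) ∧
    (f ∈ FractionalPerron.CInftyZero ℝ →
      ∀ (x₀ : ℂ) (x : ℝ → ℂ), FractionalPerron.IsSolution α lam f x₀ x →
        Filter.Tendsto x Filter.atTop (nhds 0)) := by
  obtain ⟨r, hr, hrl⟩ := FractionalPerron.exists_resolvent hα hlam
  have hne : ∀ p : ℝ, 0 ≤ p → (p : ℂ) ≠ lam := by
    rintro p hp rfl
    have h := hlam.2
    rw [Complex.arg_ofReal_of_nonneg hp, abs_zero] at h
    have := mul_pos hα.1 Real.pi_pos
    linarith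
  exact ⟨fun x₀ x hx => (FractionalPerron.stability_of_resolvent hα hne hr hrl hf hx).1,
    fun hf0 x₀ x hx => (FractionalPerron.stability_of_resolvent hα hne hr hrl hf hx).2 hf0⟩
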